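/- Let $M$ be a smooth (finite-dimensional, Hausdorff, boundaryless) manifold. Let $A^k(M)=\Gamma(\wedge^k TM)$ be the space of smooth $k$-vector fields (with $A^k(M)=0$ for $k<0$ and $A^0(M)=C^\infty(M)$), let $\mathcal A(M)=\bigoplus_k A^k(M)$, and let $[\cdot,\cdot]$ be the Schouten–Nijenhuis bracket, with the sign convention $$[X_1\wedge\cdots\wedge X_p,\,Y_1\wedge\cdots\wedge Y_q]=\sum_{i,j}(-1)^{i+j}[X_i,Y_j]\wedge X_1\wedge\cdots\widehat{X_i}\cdots\wedge X_p\wedge Y_1\wedge\cdots\widehat{Y_j}\cdots\wedge Y_q ,$$ $$[X_1\wedge\cdots\wedge X_p,f]=\sum_i(-1)^{p-i}(X_if)\,X_1\wedge\cdots\widehat{X_i}\cdots\wedge X_p .$$ An affine connection on $TM$ is a map $\widetilde\nabla:A^1(M)\times A^1(M)\to A^1(M)$, $(X,Y)\mapsto\widetilde\nabla_XY$, that is $C^\infty(M)$-linear in $X$, additive in $Y$, and satisfies $\widetilde\nabla_X(fY)=(Xf)Y+f\widetilde\nabla_XY$. A higher connection on $M$ is a map $\nabla:\mathcal A(M)\times\mathcal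 A(M)\to\mathcal A(M)$, $(X,Y)\mapsto\nabla_XY$, such that (i) $\nabla_XY\in A^{k+l-1}(M)$ for $X\in A^k(M)$, $Y\in A^l(M)$; (ii) $\nabla_{fX+X'}Y=f\nabla_XY+\nabla_{X'}Y$ for $f\in C^\infty(M)$; (iii) $\nabla_X(Y+Y')=\nabla_XY+\nabla_XY'$; (iv) $\nabla_Xf=[X,f]$ for $X\in A^k(M)$, $f\in C^\infty(M)$; (v) $\nabla_X(fY)=[X,f]\wedge Y+f\nabla_XY$ for $X\in A^k(M)$, $f\in C^\infty(M)$, $Y\in\mathcal A(M)$; (vi) $\nabla_fX=0$ for $f\in C^\infty(M)$. **Proposition.** Restriction to $A^1(M)\times A^1(M)$ is a one-to-one correspondence from the set of higher connections $\nabla$ on $M$ satisfying $$\nabla_{X\wedge Y}Z=X\wedge\nabla_YZ+(-1)^{kl}\,Y\wedge\nabla_XZ,\qquad \nabla_X(Y\wedge Z)=(\nabla_XY)\wedge Z+(-1)^{(k-1)l}\,Y\wedge\nabla_XZ$$ for all $k,l$, $X\in A^k(M)$, $Y\in A^l(M)$, $Z\in\mathcal A(M)$, onto the set of affine connections on $TM$.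 If $\nabla$ is the higher connection corresponding to the affine connection $\widetilde\nabla$, then for all vector fields $X_1,\dots,X_k,Y_1,\dots,Y_l\in A^1(M)$ and all $X,Y\in\mathcal A(M)$, $$\nabla_{X_1\wedge\cdots\wedge X_k}Y=\sum_{j=1}^k(-1)^{k-j}X_1\wedge\cdots\widehat{X_j}\cdots\wedge X_k\wedge\nabla_{X_j}Y,$$ $$\nabla_X(Y_1\wedge\cdots\wedge Y_l)=\sum_{j=1}^l(-1)^{j-1}(\nabla_XY_j)\wedge Y_1\wedge\cdots\widehat{Y_j}\cdots\wedge Y_l,$$ and hence $$\nabla_{X_1\wedge\cdots\wedge X_k}(Y_1\wedge\cdots\wedge Y_l)=\sum_{i=1}^k\sum_{j=1}^l(-1)^{k-i+j-1}X_1\wedge\cdots\widehat{X_i}\cdots\wedge X_k\wedge\widetilde\nabla_{X_i}Y_j\wedge Y_1\wedge\cdots\widehat{Y_j}\cdots\wedge Y_l .$$ -/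

import Mathlib

open scoped Manifold ContDiff Bundle

noncomputable section

/-! ### Exterior powers with integer degrees -/

/-- The subspace `Λ^k V` of the exterior algebra of `V`, for an integer `k`; it is zero for
`k < 0`. -/
def intExteriorPower (V : Type*) [AddCommGroup V] [Module ℝ V] :
    ℤ → Submodule ℝ (ExteriorAlgebra ℝ V)
  | .ofNat k => ⋀[ℝ]^k V
  | .negSucc _ => ⊥

section Manifold

variable {E : Type*} [NormedAddCommGroup E] [NormedSpace ℝ E]
  {H : Type*} [TopologicalSpace H] (I : ModelWithCorners ℝ E H)
  (M : Type*) [TopologicalSpace M] [ChartedSpace H M] [IsManifold I ∞ M]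

/-! ### Vector fields -/

/-- Smooth vector fields on `M`: smooth sections of the tangent bundle `TM`. -/
abbrev SmoothVectorField : Type _ :=
  ContMDiffSection I E ∞ (TangentSpace I : M → Type _)

variable {M}

/-- Pointwise multiplication of smooth vector fields by smooth functions. -/
instance SmoothVectorField.instSMulFunction :
    SMul C^∞⟮I, M; ℝ⟯ (SmoothVectorField I M) where
  smul f X := ⟨fun p => f p • X p, f.contMDiff.smul_section X.contMDiff⟩

/-! ### Multivector fields -/

/-- The expression, in the chart around `p`, of a (not necessarily smooth) section `X` of the
exterior bundle `Λ^• TM`: the value `X q ∈ Λ^• T_q M` is sent to `Λ^• E` by the algebra map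
induced by the trivialization `T_q M → E` of the tangent bundle around `p`. -/
def multivectorInChart (p : M) (X : ∀ q : M, ExteriorAlgebra ℝ (TangentSpace I q)) (q : M) :
    ExteriorAlgebra ℝ E :=
  ExteriorAlgebra.map ((trivializationAt E (TangentSpace I : M → Type _) p).linearMapAt ℝ q) (X q)

/-- A section of the exterior bundle `Λ^• TM` is smooth if around each point its components in the
chart at that point are smooth functions. -/
def IsSmoothMultivector (X : ∀ q : M, ExteriorAlgebra ℝ (TangentSpace I q)) : Prop :=
  ∀ (p : M) (φ : Module.Dual ℝ (ExteriorAlgebra ℝ E)),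
    ContMDiffAt I 𝓘(ℝ, ℝ) ∞ (fun q => φ (multivectorInChart I p X q)) p

variable {I}

theorem IsSmoothMultivector.add {X Y : ∀ q : M, ExteriorAlgebra ℝ (TangentSpace I q)}
    (hX : IsSmoothMultivector I X) (hY : IsSmoothMultivector I Y) :
    IsSmoothMultivector I (X + Y) := by
  intro p φ
  simpa [multivectorInChart] using! (hX p φ).add (hY p φ)

theorem isSmoothMultivector_function (f : C^∞⟮I, M; ℝ⟯) :
    IsSmoothMultivector I
      (fun q => algebraMap ℝ (ExteriorAlgebra ℝ (TangentSpace I q)) (f q)) := by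
  intro p φ
  have h : ContMDiffAt I 𝓘(ℝ, ℝ) ∞ (fun q => f q * φ 1) p :=
    (f.contMDiff p).mul contMDiffAt_const
  refine h.congr_of_eventuallyEq (Filter.Eventually.of_forall fun q => ?_)
  simp [multivectorInChart, Algebra.algebraMap_eq_smul_one]

theorem IsSmoothMultivector.mul [FiniteDimensional ℝ E]
    {X Y : ∀ q : M, ExteriorAlgebra ℝ (TangentSpace I q)}
    (hX : IsSmoothMultivector I X) (hY : IsSmoothMultivector I Y) :
    IsSmoothMultivector I (X * Y) := by
  intro p φ
  let b := (Module.finBasis ℝ E).ExteriorAlgebra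
  have h : ContMDiffAt I 𝓘(ℝ, ℝ) ∞ (fun q => ∑ s, ∑ t,
      b.coord s (multivectorInChart I p X q) * b.coord t (multivectorInChart I p Y q)
        * φ (b s * b t)) p := by
    refine ContMDiffAt.sum fun s _ => ContMDiffAt.sum fun t _ => ?_
    exact ((hX p (b.coord s)).mul (hY p (b.coord t))).mul contMDiffAt_const
  refine h.congr_of_eventuallyEq (Filter.Eventually.of_forall fun q => ?_)
  have hm : multivectorInChart I p (X * Y) q
      = multivectorInChart I p X q * multivectorInChart I p Y q := by
    simp [multivectorInChart]
  have key : ∀ x y : ExteriorAlgebra ℝ E,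
      φ (x * y) = ∑ s, ∑ t, b.coord s x * b.coord t y * φ (b s * b t) := by
    intro x y
    conv_lhs => rw [← b.sum_repr x, ← b.sum_repr y]
    simp only [Finset.sum_mul_sum, map_sum, smul_mul_smul_comm, map_smul, smul_eq_mul,
      Module.Basis.coord_apply]
  simp only [hm]
  exact key _ _

theorem isSmoothMultivector_vectorField [FiniteDimensional ℝ E] (X : SmoothVectorField I M) :
    IsSmoothMultivector I (fun q => ExteriorAlgebra.ι ℝ (X q)) := by
  intro p φ
  have hX := (Bundle.contMDiffAt_section (s := fun q => X q) p).1 (X.contMDiff p)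
  let ψ : E →L[ℝ] ℝ := LinearMap.toContinuousLinearMap (φ ∘ₗ ExteriorAlgebra.ι ℝ)
  refine (ψ.contMDiff.contMDiffAt.comp p hX).congr_of_eventuallyEq ?_
  filter_upwards [(trivializationAt E (TangentSpace I : M → Type _) p).open_baseSet.mem_nhds
    (FiberBundle.mem_baseSet_trivializationAt E (TangentSpace I : M → Type _) p)] with q hq
  simp [multivectorInChart, ψ, Bundle.Trivialization.coe_linearMapAt_of_mem _ hq]

variable (I) (M) [FiniteDimensional ℝ E]

/-- The algebra `𝒜(M)` of smooth multivector fields, that is, smooth sections of `Λ^• TM`. The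
product is the wedge product. -/
def multivectorFields : Subalgebra ℝ (∀ q : M, ExteriorAlgebra ℝ (TangentSpace I q)) where
  carrier := {X | IsSmoothMultivector I X}
  add_mem' := IsSmoothMultivector.add
  mul_mem' := IsSmoothMultivector.mul
  algebraMap_mem' r := isSmoothMultivector_function (ContMDiffMap.const r)

/-- The type of smooth multivector fields on `M`. -/
abbrev MultivectorField : Type _ := multivectorFields I M

instance : CoeFun (MultivectorField I M)
    fun _ => ∀ q : M, ExteriorAlgebra ℝ (TangentSpace I q) := ⟨Subtype.val⟩

/-- The space `A^k(M)` of smooth `k`-vector fields; it is zero for `k < 0`. -/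
def multivectorFieldsOfDegree (k : ℤ) : Submodule ℝ (MultivectorField I M) where
  carrier := {X | ∀ q, X q ∈ intExteriorPower (TangentSpace I q) k}
  add_mem' hX hY q := add_mem (hX q) (hY q)
  zero_mem' _ := zero_mem _
  smul_mem' c _ hX q := Submodule.smul_mem _ c (hX q)

variable {I M}

/-- A smooth function, as a multivector field (of degree `0`). -/
def MultivectorField.ofFunction : C^∞⟮I, M; ℝ⟯ →+* MultivectorField I M where
  toFun f := ⟨_, isSmoothMultivector_function f⟩
  map_one' := by ext q; simp
  map_mul' f g := by ext q; simp
  map_zero' := by ext q; simp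
  map_add' f g := by ext q; simp

/-- A smooth vector field, as a multivector field (of degree `1`). -/
def MultivectorField.ofVectorField (X : SmoothVectorField I M) : MultivectorField I M :=
  ⟨_, isSmoothMultivector_vectorField X⟩

/-- Pointwise multiplication of multivector fields by smooth functions. -/
instance MultivectorField.instModule : Module C^∞⟮I, M; ℝ⟯ (MultivectorField I M) :=
  Module.compHom _ MultivectorField.ofFunction

/-! ### The Schouten-Nijenhuis bracket -/

/-- The derivative at `p`, in the direction `v`, of the components of the multivector field `X` in
the chart at `p`. -/
def MultivectorField.chartDeriv (X : MultivectorField I M) (p : M) (v : TangentSpace I p) :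
    ExteriorAlgebra ℝ (TangentSpace I p) :=
  let b := (Module.finBasis ℝ E).ExteriorAlgebra
  ExteriorAlgebra.map ((trivializationAt E (TangentSpace I : M → Type _) p).symmₗ ℝ p)
    (∑ s, mvfderiv I (fun q => b.coord s (multivectorInChart I p X q)) p v • b s)

/-- The Schouten-Nijenhuis bracket `[P, Q]` of multivector fields, at the point `p`. In the
coordinates `x^i` of the chart at `p` it is
`[P, Q] = ∑ i, (P ⌊ dx^i) ∧ ∂_i Q - ∂_i P ∧ (dx^i ⌋ Q)`, where `⌊` and `⌋` are contraction from the
right and from the left, and `∂_i` differentiates components. -/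
def schoutenBracket (P Q : MultivectorField I M) (p : M) :
    ExteriorAlgebra ℝ (TangentSpace I p) :=
  let e : Module.Basis (Fin (Module.finrank ℝ E)) ℝ (TangentSpace I p) := Module.finBasis ℝ E
  ∑ i, (CliffordAlgebra.contractRight (P p) (e.coord i) * Q.chartDeriv p (e i)
    - P.chartDeriv p (e i) * CliffordAlgebra.contractLeft (e.coord i) (Q p))

/-! ### Affine connections and higher connections -/

variable (I M)

/-- An affine connection on `TM`: a map `(X, Y) ↦ D_X Y` on smooth vector fields which is
`C^∞(M)`-linear in `X`, additive in `Y`, and satisfies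
`D_X (f Y) = (X f) Y + f D_X Y`. -/
@[ext]
structure AffineConnection where
  /-- The map `(X, Y) ↦ D_X Y`. -/
  toFun : SmoothVectorField I M → SmoothVectorField I M → SmoothVectorField I M
  smul_add_left : ∀ (f : C^∞⟮I, M; ℝ⟯) (X X' Y : SmoothVectorField I M),
    toFun (f • X + X') Y = f • toFun X Y + toFun X' Y
  add_right : ∀ X Y Y' : SmoothVectorField I M, toFun X (Y + Y') = toFun X Y + toFun X Y'
  leibniz : ∀ (X : SmoothVectorField I M) (f : C^∞⟮I, M; ℝ⟯) (Y : SmoothVectorField I M) (p : M),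
    toFun X (f • Y) p = mvfderiv I f p (X p) • Y p + f p • toFun X Y p

instance : CoeFun (AffineConnection I M)
    fun _ => SmoothVectorField I M → SmoothVectorField I M → SmoothVectorField I M :=
  ⟨AffineConnection.toFun⟩

open MultivectorField in
/-- A higher (affine) connection on `M`. -/
@[ext]
structure HigherConnection where
  /-- The map `(X, Y) ↦ ∇_X Y`. -/
  toFun : MultivectorField I M → MultivectorField I M → MultivectorField I M
  degree : ∀ (k l : ℤ) (X Y : MultivectorField I M),
    X ∈ multivectorFieldsOfDegree I M k → Y ∈ multivectorFieldsOfDegree I M l →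
      toFun X Y ∈ multivectorFieldsOfDegree I M (k + l - 1)
  smul_add_left : ∀ (f : C^∞⟮I, M; ℝ⟯) (X X' Y : MultivectorField I M),
    toFun (f • X + X') Y = f • toFun X Y + toFun X' Y
  add_right : ∀ X Y Y' : MultivectorField I M, toFun X (Y + Y') = toFun X Y + toFun X Y'
  apply_function : ∀ (k : ℤ) (X : MultivectorField I M) (f : C^∞⟮I, M; ℝ⟯),
    X ∈ multivectorFieldsOfDegree I M k →
      ∀ p, toFun X (ofFunction f) p = schoutenBracket X (ofFunction f) p
  leibniz : ∀ (k : ℤ) (X : MultivectorField I M) (f : C^∞⟮I, M; ℝ⟯) (Y : MultivectorField I M),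
    X ∈ multivectorFieldsOfDegree I M k →
      ∀ p, toFun X (f • Y) p = schoutenBracket X (ofFunction f) p * Y p + f p • toFun X Y p
  function_apply : ∀ (f : C^∞⟮I, M; ℝ⟯) (X : MultivectorField I M), toFun (ofFunction f) X = 0

instance : CoeFun (HigherConnection I M)
    fun _ => MultivectorField I M → MultivectorField I M → MultivectorField I M :=
  ⟨HigherConnection.toFun⟩

variable {I M}

/-- The two Leibniz-type rules
`∇_{X ∧ Y} Z = X ∧ ∇_Y Z + (-1)^{kl} Y ∧ ∇_X Z` and
`∇_X (Y ∧ Z) = (∇_X Y) ∧ Z + (-1)^{(k-1)l} Y ∧ ∇_X Z`. -/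
structure HigherConnection.IsInduced (D : HigherConnection I M) : Prop where
  wedge_left : ∀ (k l : ℤ) (X Y Z : MultivectorField I M),
    X ∈ multivectorFieldsOfDegree I M k → Y ∈ multivectorFieldsOfDegree I M l →
      D (X * Y) Z = X * D Y Z + (k * l).negOnePow • (Y * D X Z)
  wedge_right : ∀ (k l : ℤ) (X Y Z : MultivectorField I M),
    X ∈ multivectorFieldsOfDegree I M k → Y ∈ multivectorFieldsOfDegree I M l →
      D X (Y * Z) = D X Y * Z + ((k - 1) * l).negOnePow • (Y * D X Z)

/-- The decomposable multivector field `X_0 ∧ ⋯ ∧ X_{k-1}`. -/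
def wedgeFields {k : ℕ} (X : Fin k → SmoothVectorField I M) : MultivectorField I M :=
  (List.ofFn fun i => MultivectorField.ofVectorField (X i)).prod

/-- The decomposable multivector field `X_0 ∧ ⋯ ∧ X_{k-1}` with the factor `X_j` omitted. -/
def wedgeFieldsOmit {k : ℕ} (X : Fin k → SmoothVectorField I M) (j : Fin k) :
    MultivectorField I M :=
  ((List.ofFn fun i => MultivectorField.ofVectorField (X i)).eraseIdx j).prod

end Manifold

end

/-! ### Algebra in the exterior algebra -/

section ExteriorAlgebra

open CliffordAlgebra (involute contractLeft contractRight)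

namespace ExteriorAlgebra

variable {R V W : Type*} [CommRing R] [AddCommGroup V] [Module R V] [AddCommGroup W] [Module R W]

theorem ι_mul_ι_comm (v w : V) : ι R v * ι R w = -(ι R w * ι R v) :=
  eq_neg_of_add_eq_zero_left (ι_add_mul_swap v w)

/-- Vectors commute with multivectors up to the grade involution. -/
theorem mul_ι_eq_ι_mul_involute (x : ExteriorAlgebra R V) (v : V) :
    x * ι R v = ι R v * involute x := by
  induction x using ExteriorAlgebra.induction with
  | algebraMap r => rw [AlgHom.commutes, Algebra.commutes]
  | ι w =>
    have : involute (ι R w) = -ι R w := CliffordAlgebra.involute_ι w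
    rw [this, ι_mul_ι_comm, mul_neg]
  | mul x y hx hy => rw [mul_assoc, hy, ← mul_assoc, hx, map_mul, mul_assoc]
  | add x y hx hy => rw [add_mul, hx, hy, map_add, mul_add]

theorem ι_mul_involute_eq (x : ExteriorAlgebra R V) (v : V) :
    ι R v * involute x = x * ι R v :=
  (mul_ι_eq_ι_mul_involute x v).symm

theorem contractLeft_mul (a : Module.Dual R V) (x y : ExteriorAlgebra R V) :
    contractLeft a (x * y) = contractLeft a x * y + involute x * contractLeft a y := by
  induction x using CliffordAlgebra.left_induction generalizing y with
  | algebraMap r => simp [CliffordAlgebra.contractLeft_algebraMap_mul]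
  | add x z hx hz => simp only [add_mul, map_add, hx, hz]; abel
  | ι_mul v x hx =>
    rw [mul_assoc, CliffordAlgebra.contractLeft_ι_mul, hx, CliffordAlgebra.contractLeft_ι_mul,
      map_mul, CliffordAlgebra.involute_ι, sub_mul, smul_mul_assoc, mul_add, mul_assoc,
      neg_mul, neg_mul, mul_assoc]
    abel

theorem contractRight_mul (a : Module.Dual R V) (x y : ExteriorAlgebra R V) :
    contractRight (x * y) a = x * contractRight y a + contractRight x a * involute y := by
  induction y using CliffordAlgebra.right_induction generalizing x with
  | algebraMap r => simp [CliffordAlgebra.contractRight_mul_algebraMap]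
  | add y z hx hz => simp only [mul_add, map_add, LinearMap.add_apply, hx, hz]; abel
  | mul_ι v y hx =>
    rw [← mul_assoc, CliffordAlgebra.contractRight_mul_ι, hx, CliffordAlgebra.contractRight_mul_ι,
      map_mul, CliffordAlgebra.involute_ι, mul_sub, mul_smul_comm, add_mul, mul_assoc,
      mul_neg, mul_neg, mul_assoc]
    abel

/-- The derivation of the exterior algebra which extends the linear map `v ↦ ∑ i, a i v • A i`. -/
def sumContract {n : Type*} [Fintype n] (a : n → Module.Dual R V) (A : n → V) :
    ExteriorAlgebra R V →ₗ[R] ExteriorAlgebra R V :=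
  ∑ i, LinearMap.mulLeft R (ι R (A i)) ∘ₗ contractLeft (a i)

section sumContract

variable {n : Type*} [Fintype n] (a : n → Module.Dual R V) (A : n → V)

theorem sumContract_apply (x : ExteriorAlgebra R V) :
    sumContract a A x = ∑ i, ι R (A i) * contractLeft (a i) x := by
  simp [sumContract]

theorem sumContract_mul (x y : ExteriorAlgebra R V) :
    sumContract a A (x * y) = sumContract a A x * y + x * sumContract a A y := by
  simp only [sumContract_apply, contractLeft_mul, mul_add, Finset.sum_add_distrib, Finset.sum_mul,
    Finset.mul_sum, ← mul_assoc, ι_mul_involute_eq]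

theorem sumContract_algebraMap (r : R) : sumContract a A (algebraMap R _ r) = 0 := by
  simp only [sumContract_apply]
  exact Finset.sum_eq_zero fun i _ => by
    rw [CliffordAlgebra.contractLeft_algebraMap, mul_zero]

theorem sumContract_ι (v : V) : sumContract a A (ι R v) = ι R (∑ i, a i v • A i) := by
  rw [sumContract_apply, map_sum]
  refine Finset.sum_congr rfl fun i _ => ?_
  have : contractLeft (a i) (ι R v) = algebraMap R _ (a i v) := CliffordAlgebra.contractLeft_ι _ _ _
  rw [this, ← Algebra.commutes, ← Algebra.smul_def, map_smul]

end sumContract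

theorem map_mem_exteriorPower (f : V →ₗ[R] W) {k : ℕ} {x : ExteriorAlgebra R V}
    (hx : x ∈ ⋀[R]^k V) : map f x ∈ ⋀[R]^k W := by
  have h : (⋀[R]^k V).map (map f).toLinearMap ≤ ⋀[R]^k W := by
    rw [Submodule.map_pow, ι_range_map_map]
    exact pow_left_mono k LinearMap.map_le_range
  exact h (Submodule.mem_map_of_mem hx)

theorem involute_of_mem_exteriorPower {k : ℕ} {x : ExteriorAlgebra R V} (hx : x ∈ ⋀[R]^k V) :
    involute x = (-1 : ℤˣ) ^ k • x := by
  induction hx using Submodule.pow_induction_on_left' with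
  | algebraMap r => simp
  | add x y i hx hy ihx ihy => rw [map_add, ihx, ihy, smul_add]
  | mem_mul v hv i x hx ih =>
    obtain ⟨v, rfl⟩ := hv
    have : involute (ι R v) = -ι R v := CliffordAlgebra.involute_ι v
    rw [map_mul, ih, this, pow_succ', mul_smul, mul_smul_comm]
    simp

theorem mul_comm_of_mem_exteriorPower {k l : ℕ} {x y : ExteriorAlgebra R V}
    (hx : x ∈ ⋀[R]^k V) (hy : y ∈ ⋀[R]^l V) : x * y = (-1 : ℤˣ) ^ (k * l) • (y * x) := by
  induction hy using Submodule.pow_induction_on_left' with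
  | algebraMap r => simp [Algebra.commutes]
  | add y z i hy hz ihy ihz => rw [mul_add, ihy, ihz, add_mul, smul_add]
  | mem_mul v hv i y hy ih =>
    obtain ⟨v, rfl⟩ := hv
    rw [← mul_assoc, mul_ι_eq_ι_mul_involute, involute_of_mem_exteriorPower hx, mul_smul_comm,
      smul_mul_assoc, mul_assoc, ih, mul_smul_comm, smul_smul, mul_assoc, ← pow_add]
    congr 2
    rw [Nat.succ_eq_add_one]
    ring

theorem contractRight_mem_exteriorPower {k : ℕ} {x : ExteriorAlgebra R V}
    (hx : x ∈ ⋀[R]^(k + 1) V) (a : Module.Dual R V) : contractRight x a ∈ ⋀[R]^k V := by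
  induction k generalizing x with
  | zero =>
    rw [zero_add, exteriorPower, pow_one] at hx
    obtain ⟨v, rfl⟩ := hx
    have : contractRight (ι R v) a = algebraMap R _ (a v) := CliffordAlgebra.contractRight_ι _ _ _
    rw [this, exteriorPower, pow_zero]
    exact Submodule.algebraMap_mem _
  | succ k ih =>
    rw [exteriorPower, pow_succ] at hx
    refine Submodule.mul_induction_on hx (fun y hy v hv => ?_) fun y z hy hz => ?_
    · obtain ⟨v, rfl⟩ := hv
      have : contractRight (y * ι R v) a = a v • y - contractRight y a * ι R v :=
        CliffordAlgebra.contractRight_mul_ι _ _ _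
      rw [this]
      refine sub_mem (Submodule.smul_mem _ _ hy) ?_
      rw [exteriorPower, pow_succ]
      exact Submodule.mul_mem_mul (ih hy) ⟨v, rfl⟩
    · rw [map_add, LinearMap.add_apply]
      exact add_mem hy hz

theorem contractLeft_mem_exteriorPower {k : ℕ} {x : ExteriorAlgebra R V}
    (hx : x ∈ ⋀[R]^(k + 1) V) (a : Module.Dual R V) : contractLeft a x ∈ ⋀[R]^k V := by
  induction k generalizing x with
  | zero =>
    rw [zero_add, exteriorPower, pow_one] at hx
    obtain ⟨v, rfl⟩ := hx
    have : contractLeft a (ι R v) = algebraMap R _ (a v) := CliffordAlgebra.contractLeft_ι _ _ _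
    rw [this, exteriorPower, pow_zero]
    exact Submodule.algebraMap_mem _
  | succ k ih =>
    rw [exteriorPower, pow_succ'] at hx
    refine Submodule.mul_induction_on hx (fun v hv y hy => ?_) fun y z hy hz => ?_
    · obtain ⟨v, rfl⟩ := hv
      have : contractLeft a (ι R v * y) = a v • y - ι R v * contractLeft a y :=
        CliffordAlgebra.contractLeft_ι_mul _ _ _
      rw [this]
      refine sub_mem (Submodule.smul_mem _ _ hy) ?_
      rw [exteriorPower, pow_succ']
      exact Submodule.mul_mem_mul ⟨v, rfl⟩ (ih hy)
    · rw [map_add]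
      exact add_mem hy hz

theorem contractRight_of_mem_exteriorPower_zero {x : ExteriorAlgebra R V}
    (hx : x ∈ ⋀[R]^0 V) (a : Module.Dual R V) : contractRight x a = 0 := by
  rw [exteriorPower, pow_zero] at hx
  obtain ⟨r, rfl⟩ := Submodule.mem_one.1 hx
  exact CliffordAlgebra.contractRight_algebraMap (Q := (0 : QuadraticForm R V)) _ _

theorem sumContract_mem_exteriorPower {n : Type*} [Fintype n] (a : n → Module.Dual R V)
    (A : n → V) {k : ℕ} {x : ExteriorAlgebra R V} (hx : x ∈ ⋀[R]^k V) :
    sumContract a A x ∈ ⋀[R]^k V := by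
  cases k with
  | zero =>
    rw [exteriorPower, pow_zero] at hx
    obtain ⟨r, rfl⟩ := Submodule.mem_one.1 hx
    rw [sumContract_algebraMap]
    exact zero_mem _
  | succ k =>
    rw [sumContract_apply, exteriorPower, pow_succ']
    exact sum_mem fun i _ =>
      Submodule.mul_mem_mul ⟨_, rfl⟩ (contractLeft_mem_exteriorPower hx (a i))

theorem ι_ιInv_of_mem {x : ExteriorAlgebra R V} (hx : x ∈ ⋀[R]^1 V) : ι R (ιInv x) = x := by
  rw [exteriorPower, pow_one] at hx
  obtain ⟨v, rfl⟩ := hx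
  rw [ι_leftInverse v]

end ExteriorAlgebra

section IntExteriorPower

open ExteriorAlgebra

variable {V W : Type*} [AddCommGroup V] [Module ℝ V] [AddCommGroup W] [Module ℝ W]

theorem intExteriorPower_induction {k : ℤ} {x : ExteriorAlgebra ℝ V}
    {P : ℤ → ExteriorAlgebra ℝ V → Prop}
    (hx : x ∈ intExteriorPower V k) (hzero : ∀ k, P k 0) (hnat : ∀ k : ℕ, ∀ x ∈ ⋀[ℝ]^k V, P k x) :
    P k x := by
  cases k with
  | ofNat k => exact hnat k x hx
  | negSucc k => rw [(Submodule.mem_bot ℝ).1 hx]; exact hzero _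

theorem map_mem_intExteriorPower (f : V →ₗ[ℝ] W) {k : ℤ} {x : ExteriorAlgebra ℝ V}
    (hx : x ∈ intExteriorPower V k) : map f x ∈ intExteriorPower W k := by
  refine intExteriorPower_induction (P := fun k x => map f x ∈ intExteriorPower W k) hx
    (fun k => by simp) fun k x hx => map_mem_exteriorPower f hx

theorem mul_mem_intExteriorPower {k l : ℤ} {x y : ExteriorAlgebra ℝ V}
    (hx : x ∈ intExteriorPower V k) (hy : y ∈ intExteriorPower V l) :
    x * y ∈ intExteriorPower V (k + l) := by
  refine intExteriorPower_induction (P := fun k x => x * y ∈ intExteriorPower V (k + l)) hx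
    (fun k => by simp) fun k x hx => ?_
  refine intExteriorPower_induction (P := fun l y => x * y ∈ intExteriorPower V (k + l)) hy
    (fun k => by simp) fun l y hy => ?_
  change x * y ∈ ⋀[ℝ]^(k + l) V
  rw [exteriorPower, pow_add]
  exact Submodule.mul_mem_mul hx hy

theorem involute_of_mem_intExteriorPower {k : ℤ} {x : ExteriorAlgebra ℝ V}
    (hx : x ∈ intExteriorPower V k) : involute x = k.negOnePow • x :=
  intExteriorPower_induction (P := fun k x => involute x = k.negOnePow • x) hx
    (fun k => by simp) fun k x hx => by
      rw [involute_of_mem_exteriorPower hx, Int.negOnePow_def, zpow_natCast]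

theorem mul_comm_of_mem_intExteriorPower {k l : ℤ} {x y : ExteriorAlgebra ℝ V}
    (hx : x ∈ intExteriorPower V k) (hy : y ∈ intExteriorPower V l) :
    x * y = (k * l).negOnePow • (y * x) := by
  refine intExteriorPower_induction (P := fun k x => x * y = (k * l).negOnePow • (y * x)) hx
    (fun k => by simp) fun k x hx => ?_
  refine intExteriorPower_induction (P := fun l y => x * y = (k * l).negOnePow • (y * x)) hy
    (fun k => by simp) fun l y hy => ?_
  rw [mul_comm_of_mem_exteriorPower hx hy, ← Nat.cast_mul, Int.negOnePow_def, zpow_natCast]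

theorem contractRight_mem_intExteriorPower {k : ℤ} {x : ExteriorAlgebra ℝ V}
    (hx : x ∈ intExteriorPower V k) (a : Module.Dual ℝ V) :
    contractRight x a ∈ intExteriorPower V (k - 1) := by
  refine intExteriorPower_induction
    (P := fun k x => contractRight x a ∈ intExteriorPower V (k - 1)) hx
    (fun k => by simp) fun k x hx => ?_
  cases k with
  | zero => rw [contractRight_of_mem_exteriorPower_zero hx]; exact zero_mem _
  | succ k =>
    rw [Nat.cast_succ, add_sub_cancel_right]
    exact contractRight_mem_exteriorPower hx a

theorem sumContract_mem_intExteriorPower {n : Type*} [Fintype n] (a : n → Module.Dual ℝ V)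
    (A : n → V) {k : ℤ} {x : ExteriorAlgebra ℝ V} (hx : x ∈ intExteriorPower V k) :
    sumContract a A x ∈ intExteriorPower V k :=
  intExteriorPower_induction (P := fun k x => sumContract a A x ∈ intExteriorPower V k) hx
    (fun k => by simp) fun k x hx => sumContract_mem_exteriorPower a A hx

theorem ι_mem_intExteriorPower (v : V) : ι ℝ v ∈ intExteriorPower V 1 := by
  change ι ℝ v ∈ ⋀[ℝ]^1 V
  rw [exteriorPower, pow_one]
  exact ⟨v, rfl⟩

theorem algebraMap_mem_intExteriorPower (r : ℝ) :
    algebraMap ℝ (ExteriorAlgebra ℝ V) r ∈ intExteriorPower V 0 := by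
  change _ ∈ ⋀[ℝ]^0 V
  rw [exteriorPower, pow_zero]
  exact Submodule.algebraMap_mem r

end IntExteriorPower

end ExteriorAlgebra

section Manifold

variable {E : Type*} [NormedAddCommGroup E] [NormedSpace ℝ E]
  {H : Type*} [TopologicalSpace H] (I : ModelWithCorners ℝ E H)
  {M : Type*} [TopologicalSpace M] [ChartedSpace H M]

open Filter Topology

/-! ### Componentwise smooth functions into a vector space without a norm -/

/-- A function into a real vector space is componentwise smooth at a point if its composition with
each linear form is smooth there. -/
def ComponentwiseSmoothAt {A : Type*} [AddCommGroup A] [Module ℝ A] (F : M → A) (p : M) : Prop :=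
  ∀ φ : Module.Dual ℝ A, ContMDiffAt I 𝓘(ℝ, ℝ) ∞ (fun q => φ (F q)) p

namespace ComponentwiseSmoothAt

variable {I} {A B : Type*} [AddCommGroup A] [Module ℝ A] [AddCommGroup B] [Module ℝ B]
  {F G : M → A} {p : M}

theorem congr (hF : ComponentwiseSmoothAt I F p) (h : ∀ᶠ q in 𝓝 p, F q = G q) :
    ComponentwiseSmoothAt I G p := fun φ =>
  (hF φ).congr_of_eventuallyEq (h.mono fun q hq => by simp only [hq])

theorem const (a : A) : ComponentwiseSmoothAt I (fun _ : M => a) p := fun _ => contMDiffAt_const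

theorem add (hF : ComponentwiseSmoothAt I F p) (hG : ComponentwiseSmoothAt I G p) :
    ComponentwiseSmoothAt I (fun q => F q + G q) p := fun φ => by
  simpa only [map_add] using! (hF φ).add (hG φ)

theorem smul {f : M → ℝ} (hf : ContMDiffAt I 𝓘(ℝ, ℝ) ∞ f p) (hF : ComponentwiseSmoothAt I F p) :
    ComponentwiseSmoothAt I (fun q => f q • F q) p := fun φ => by
  simpa only [map_smul, smul_eq_mul] using! hf.mul (hF φ)

theorem sum {n : Type*} {s : Finset n} {F : n → M → A}
    (hF : ∀ i ∈ s, ComponentwiseSmoothAt I (F i) p) :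
    ComponentwiseSmoothAt I (fun q => ∑ i ∈ s, F i q) p := fun φ => by
  simpa only [map_sum] using! ContMDiffAt.sum fun i hi => hF i hi φ

theorem linearMap (L : A →ₗ[ℝ] B) (hF : ComponentwiseSmoothAt I F p) :
    ComponentwiseSmoothAt I (fun q => L (F q)) p := fun φ => hF (φ ∘ₗ L)

/-- Application of a family of linear maps which depends smoothly on the point. -/
theorem apply [FiniteDimensional ℝ A] {L : M → A →ₗ[ℝ] B}
    (hL : ∀ a, ComponentwiseSmoothAt I (fun q => L q a) p) (hF : ComponentwiseSmoothAt I F p) :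
    ComponentwiseSmoothAt I (fun q => L q (F q)) p := by
  let b := Module.finBasis ℝ A
  refine (sum (s := Finset.univ) fun i _ => (hL (b i)).smul (hF (b.coord i))).congr
    (Eventually.of_forall fun q => ?_)
  conv_rhs => rw [← b.sum_repr (F q), map_sum]
  simp only [map_smul, Module.Basis.coord_apply]

theorem mul {A : Type*} [Ring A] [Algebra ℝ A] [FiniteDimensional ℝ A] {F G : M → A}
    (hF : ComponentwiseSmoothAt I F p) (hG : ComponentwiseSmoothAt I G p) :
    ComponentwiseSmoothAt I (fun q => F q * G q) p :=
  apply (L := fun q => LinearMap.mulLeft ℝ (F q))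
    (fun a => hF.linearMap (LinearMap.mulRight ℝ a)) hG

theorem contMDiffAt [FiniteDimensional ℝ E] {F : M → E} (hF : ComponentwiseSmoothAt I F p) :
    ContMDiffAt I 𝓘(ℝ, E) ∞ F p := by
  let b := Module.finBasis ℝ E
  have h : ContMDiffAt I 𝓘(ℝ, E) ∞ (fun q => ∑ i, b.coord i (F q) • b i) p :=
    ContMDiffAt.sum fun i _ => (hF (b.coord i)).smul contMDiffAt_const
  refine h.congr_of_eventuallyEq (Eventually.of_forall fun q => ?_)
  simp only [Module.Basis.coord_apply, b.sum_repr]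

theorem of_contMDiffAt [FiniteDimensional ℝ E] {F : M → E} (hF : ContMDiffAt I 𝓘(ℝ, E) ∞ F p) :
    ComponentwiseSmoothAt I F p := fun φ =>
  (LinearMap.toContinuousLinearMap φ).contMDiff.contMDiffAt.comp p hF

/-- The derivative can be computed in components. -/
theorem map_sum_mvfderiv {n : Type*} [Fintype n] (b : Module.Basis n ℝ A)
    (hF : ComponentwiseSmoothAt I F p) (v : TangentSpace I p) (φ : Module.Dual ℝ A) :
    φ (∑ s, mvfderiv I (fun q => b.coord s (F q)) p v • b s)
      = mvfderiv I (fun q => φ (F q)) p v := by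
  have hφ : (fun q => φ (F q)) = fun q => ∑ s, b.coord s (F q) * φ (b s) := by
    funext q
    conv_lhs => rw [← b.sum_repr (F q), map_sum]
    simp only [map_smul, Module.Basis.coord_apply, smul_eq_mul]
  have key : ∀ t : Finset n,
      MDifferentiableAt I 𝓘(ℝ, ℝ) (fun q => ∑ s ∈ t, b.coord s (F q) * φ (b s)) p ∧
      mvfderiv I (fun q => ∑ s ∈ t, b.coord s (F q) * φ (b s)) p v
        = ∑ s ∈ t, mvfderiv I (fun q => b.coord s (F q)) p v * φ (b s) := by
    classical
    intro t
    induction t using Finset.induction_on with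
    | empty =>
      simp only [Finset.sum_empty]
      exact ⟨mdifferentiableAt_const, by rw [mvfderiv_const]; rfl⟩
    | insert s t hs ih =>
      have h1 : MDifferentiableAt I 𝓘(ℝ, ℝ) (fun q => b.coord s (F q)) p :=
        (hF (b.coord s)).mdifferentiableAt (by simp)
      have h2 : MDifferentiableAt I 𝓘(ℝ, ℝ) (fun _ : M => φ (b s)) p := mdifferentiableAt_const
      have h3 : MDifferentiableAt I 𝓘(ℝ, ℝ) (fun q => b.coord s (F q) * φ (b s)) p := h1.mul h2
      simp only [Finset.sum_insert hs]
      refine ⟨h3.add ih.1, ?_⟩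
      rw [mvfderiv_fun_add h3 ih.1, mvfderiv_fun_mul h1 h2, mvfderiv_const,
        add_apply, ih.2]
      simp [mul_comm]
  rw [hφ, (key Finset.univ).2, map_sum]
  simp only [map_smul, smul_eq_mul]

end ComponentwiseSmoothAt

instance ExteriorAlgebra.instFiniteDimensional (V : Type*) [AddCommGroup V] [Module ℝ V]
    [FiniteDimensional ℝ V] : FiniteDimensional ℝ (ExteriorAlgebra ℝ V) :=
  Module.Finite.of_basis (Module.finBasis ℝ V).ExteriorAlgebra

/-- Application of the algebra maps which are induced by a smooth family of linear maps. -/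
theorem ComponentwiseSmoothAt.map_exteriorAlgebra {V W : Type*} [AddCommGroup V] [Module ℝ V]
    [FiniteDimensional ℝ V] [AddCommGroup W] [Module ℝ W] [FiniteDimensional ℝ W] {p : M}
    {L : M → V →ₗ[ℝ] W} (hL : ∀ v, ComponentwiseSmoothAt I (fun q => L q v) p)
    {F : M → ExteriorAlgebra ℝ V} (hF : ComponentwiseSmoothAt I F p) :
    ComponentwiseSmoothAt I (fun q => ExteriorAlgebra.map (L q) (F q)) p := by
  refine ComponentwiseSmoothAt.apply (L := fun q => (ExteriorAlgebra.map (L q)).toLinearMap)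
    (fun x => ?_) hF
  simp only [AlgHom.toLinearMap_apply]
  induction x using ExteriorAlgebra.induction with
  | algebraMap r => simpa only [AlgHom.commutes] using const _
  | ι v => simpa only [ExteriorAlgebra.map_apply_ι] using (hL v).linearMap (ExteriorAlgebra.ι ℝ)
  | mul x y hx hy => simpa only [map_mul] using hx.mul hy
  | add x y hx hy => simpa only [map_add] using hx.add hy

variable [IsManifold I ∞ M]

/-! ### Tangent coordinates -/

/-- The trivialization of the tangent bundle over the chart at `p`, as a linear map. -/
noncomputable abbrev tangentChart (p q : M) : TangentSpace I q →ₗ[ℝ] E :=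
  (trivializationAt E (TangentSpace I : M → Type _) p).linearMapAt ℝ q

/-- The inverse of `tangentChart`. -/
noncomputable abbrev tangentChartSymm (p q : M) : E →ₗ[ℝ] TangentSpace I q :=
  (trivializationAt E (TangentSpace I : M → Type _) p).symmₗ ℝ q

/-- The domain of the chart at `p`. -/
abbrev tangentBase (p : M) : Set M := (trivializationAt E (TangentSpace I : M → Type _) p).baseSet

variable {I}

theorem tangentBase_mem_nhds {p q : M} (hq : q ∈ tangentBase I p) : tangentBase I p ∈ 𝓝 q :=
  (trivializationAt E (TangentSpace I : M → Type _) p).open_baseSet.mem_nhds hq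

theorem mem_tangentBase_self (p : M) : p ∈ tangentBase I p :=
  FiberBundle.mem_baseSet_trivializationAt' p

theorem tangentChart_tangentChartSymm {p q : M} (hq : q ∈ tangentBase I p) (v : E) :
    tangentChart I p q (tangentChartSymm I p q v) = v :=
  (trivializationAt E (TangentSpace I : M → Type _) p).linearMapAt_symmₗ hq v

theorem tangentChartSymm_tangentChart {p q : M} (hq : q ∈ tangentBase I p) (v : TangentSpace I q) :
    tangentChartSymm I p q (tangentChart I p q v) = v :=
  (trivializationAt E (TangentSpace I : M → Type _) p).symmₗ_linearMapAt hq v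

theorem map_tangentChartSymm_multivectorInChart {p q : M} (hq : q ∈ tangentBase I p)
    (X : ∀ q : M, ExteriorAlgebra ℝ (TangentSpace I q)) :
    ExteriorAlgebra.map (tangentChartSymm I p q) (multivectorInChart I p X q) = X q :=
  (ExteriorAlgebra.leftInverse_map_iff.2 (tangentChartSymm_tangentChart hq)) (X q)

theorem contMDiffOn_tangentChartSymm (p : M) (v : E) :
    ContMDiffOn I (I.prod 𝓘(ℝ, E)) ∞
      (fun q => (⟨q, tangentChartSymm I p q v⟩ : TangentBundle I M)) (tangentBase I p) := by
  rw [(trivializationAt E (TangentSpace I : M → Type _) p).contMDiffOn_section_baseSet_iff]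
  refine (contMDiffOn_const (c := v)).congr fun q hq => ?_
  have := tangentChart_tangentChartSymm hq v
  rwa [tangentChart, Bundle.Trivialization.coe_linearMapAt_of_mem _ hq] at this

theorem componentwiseSmoothAt_tangentChart [FiniteDimensional ℝ E] {p q : M}
    (hq : q ∈ tangentBase I p) {s : ∀ q : M, TangentSpace I q}
    (hs : ContMDiffAt I (I.prod 𝓘(ℝ, E)) ∞ (fun q => (⟨q, s q⟩ : TangentBundle I M)) q) :
    ComponentwiseSmoothAt I (fun q => tangentChart I p q (s q)) q := by
  rw [(trivializationAt E (TangentSpace I : M → Type _) p).contMDiffAt_section_iff hq] at hs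
  refine (ComponentwiseSmoothAt.of_contMDiffAt hs).congr ?_
  filter_upwards [tangentBase_mem_nhds hq] with q hq
  rw [tangentChart, Bundle.Trivialization.coe_linearMapAt_of_mem _ hq]

theorem contMDiffAt_of_componentwiseSmoothAt_tangentChart [FiniteDimensional ℝ E] {p : M}
    {s : ∀ q : M, TangentSpace I q}
    (hs : ComponentwiseSmoothAt I (fun q => tangentChart I p q (s q)) p) :
    ContMDiffAt I (I.prod 𝓘(ℝ, E)) ∞ (fun q => (⟨q, s q⟩ : TangentBundle I M)) p := by
  rw [(trivializationAt E (TangentSpace I : M → Type _) p).contMDiffAt_section_iff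
    (mem_tangentBase_self p)]
  refine hs.contMDiffAt.congr_of_eventuallyEq ?_
  filter_upwards [tangentBase_mem_nhds (I := I) (mem_tangentBase_self p)] with q hq
  rw [tangentChart, Bundle.Trivialization.coe_linearMapAt_of_mem _ hq]

variable [FiniteDimensional ℝ E]

/-- A smooth multivector field has smooth components in every chart. -/
theorem MultivectorField.componentwiseSmoothAt (X : MultivectorField I M) {p q : M}
    (hq : q ∈ tangentBase I p) : ComponentwiseSmoothAt I (multivectorInChart I p X) q := by
  have hL : ∀ v, ComponentwiseSmoothAt I
      (fun q' => (tangentChart I p q' ∘ₗ tangentChartSymm I q q') v) q := fun v =>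
    componentwiseSmoothAt_tangentChart hq ((contMDiffOn_tangentChartSymm q v).contMDiffAt
      (tangentBase_mem_nhds (I := I) (mem_tangentBase_self q)))
  refine (ComponentwiseSmoothAt.map_exteriorAlgebra I hL
    (F := multivectorInChart I q X) (X.2 q)).congr ?_
  filter_upwards [tangentBase_mem_nhds (I := I) (mem_tangentBase_self q)] with q' hq'
  rw [← ExteriorAlgebra.map_comp_map, AlgHom.comp_apply,
    map_tangentChartSymm_multivectorInChart hq']
  rfl

/-! ### Bump functions and extension of local objects -/

section Bump

variable [T2Space M]

theorem exists_contMDiffMap_eventually_eq_one (p : M) {U : Set M} (hU : U ∈ 𝓝 p) :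
    ∃ χ : C^∞⟮I, M; ℝ⟯, (∀ᶠ q in 𝓝 p, χ q = 1) ∧ tsupport χ ⊆ U := by
  obtain ⟨f, -, hf⟩ := (SmoothBumpFunction.nhds_basis_tsupport (I := I) p).mem_iff.1 hU
  exact ⟨⟨f, f.contMDiff⟩, f.eventuallyEq_one, hf⟩

theorem exists_contMDiffMap_eq_zero {p : M} {P : M → Prop} (hP : ∀ᶠ q in 𝓝 p, P q) :
    ∃ g : C^∞⟮I, M; ℝ⟯, g p = 0 ∧ ∀ q, ¬ P q → g q = 1 := by
  obtain ⟨χ, h1, h2⟩ := exists_contMDiffMap_eventually_eq_one (I := I) p hP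
  refine ⟨1 - χ, ?_, fun q hq => ?_⟩
  · simp [h1.self_of_nhds]
  · simp [image_eq_zero_of_notMem_tsupport fun h => hq (h2 h)]

theorem exists_contMDiffMap_eventually_eq {p : M} {U : Set M} (hU : U ∈ 𝓝 p) {f : M → ℝ}
    (hf : ∀ q ∈ U, ContMDiffAt I 𝓘(ℝ, ℝ) ∞ f q) :
    ∃ g : C^∞⟮I, M; ℝ⟯, ∀ᶠ q in 𝓝 p, g q = f q := by
  obtain ⟨χ, h1, h2⟩ := exists_contMDiffMap_eventually_eq_one (I := I) p hU
  refine ⟨⟨fun q => χ q * f q, fun q => ?_⟩, h1.mono fun q hq => ?_⟩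
  · by_cases hq : q ∈ tsupport χ
    · exact (χ.contMDiff q).mul (hf q (h2 hq))
    · refine (contMDiffAt_const (c := (0 : ℝ))).congr_of_eventuallyEq ?_
      filter_upwards [(isClosed_tsupport χ).isOpen_compl.mem_nhds hq] with q' hq'
      rw [image_eq_zero_of_notMem_tsupport hq', zero_mul]
  · change χ q * f q = f q
    rw [hq, one_mul]

theorem exists_vectorField_constant_in_chart (p : M) (v : TangentSpace I p) :
    ∃ V : SmoothVectorField I M, V p = v ∧
      ∀ᶠ q in 𝓝 p, tangentChart I p q (V q) = tangentChart I p p v := by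
  have hp := mem_tangentBase_self (I := I) p
  obtain ⟨χ, h1, h2⟩ :=
    exists_contMDiffMap_eventually_eq_one (I := I) p (tangentBase_mem_nhds hp)
  have hs := contMDiffOn_tangentChartSymm (I := I) p (tangentChart I p p v)
  refine ⟨⟨_, χ.contMDiff.contMDiffOn.smul_section_of_tsupport
    (trivializationAt E (TangentSpace I : M → Type _) p).open_baseSet h2 hs⟩, ?_, ?_⟩
  · change χ p • tangentChartSymm I p p (tangentChart I p p v) = v
    rw [h1.self_of_nhds, one_smul, tangentChartSymm_tangentChart hp]
  · filter_upwards [h1, tangentBase_mem_nhds hp] with q hq hq'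
    change tangentChart I p q (χ q • tangentChartSymm I p q (tangentChart I p p v)) = _
    rw [hq, one_smul, tangentChart_tangentChartSymm hq']

end Bump

end Manifold

section Manifold

variable {E : Type*} [NormedAddCommGroup E] [NormedSpace ℝ E]
  {H : Type*} [TopologicalSpace H] (I : ModelWithCorners ℝ E H)
  {M : Type*} [TopologicalSpace M] [ChartedSpace H M]

open Filter Topology

/-! ### Differentiation of components -/

section ComponentDeriv

variable {I} in
theorem mvfderiv_congr_of_eventuallyEq {f g : M → ℝ} {p : M} (h : f =ᶠ[𝓝 p] g) :
    mvfderiv I f p = mvfderiv I g p := by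
  unfold mvfderiv
  rw [h.mfderiv_eq]
  rfl

variable {A B : Type*} [AddCommGroup A] [Module ℝ A] [FiniteDimensional ℝ A]
  [AddCommGroup B] [Module ℝ B] [FiniteDimensional ℝ B]

/-- The derivative of a function into a finite-dimensional real vector space without a norm. -/
noncomputable def componentDeriv (F : M → A) (p : M) : TangentSpace I p →ₗ[ℝ] A :=
  ∑ s, (mvfderiv I (fun q => (Module.finBasis ℝ A).coord s (F q)) p).toLinearMap.smulRight
    (Module.finBasis ℝ A s)

variable {I} {F G : M → A} {p : M}

theorem eq_of_forall_dual_eq {x y : A} (h : ∀ φ : Module.Dual ℝ A, φ x = φ y) : x = y := by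
  rw [← sub_eq_zero, ← Module.forall_dual_apply_eq_zero_iff ℝ]
  intro φ
  rw [map_sub, h, sub_self]

namespace ComponentwiseSmoothAt

theorem dual_componentDeriv (hF : ComponentwiseSmoothAt I F p) (v : TangentSpace I p)
    (φ : Module.Dual ℝ A) :
    φ (componentDeriv I F p v) = mvfderiv I (fun q => φ (F q)) p v := by
  rw [← hF.map_sum_mvfderiv (Module.finBasis ℝ A) v φ]
  simp [componentDeriv]

omit [FiniteDimensional ℝ A] in
theorem mdifferentiableAt (hF : ComponentwiseSmoothAt I F p) (φ : Module.Dual ℝ A) :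
    MDifferentiableAt I 𝓘(ℝ, ℝ) (fun q => φ (F q)) p :=
  ContMDiffAt.mdifferentiableAt (hF φ) (by simp)

theorem sum_mvfderiv_eq {n : Type*} [Fintype n] (b : Module.Basis n ℝ A)
    (hF : ComponentwiseSmoothAt I F p) (v : TangentSpace I p) :
    ∑ s, mvfderiv I (fun q => b.coord s (F q)) p v • b s = componentDeriv I F p v :=
  eq_of_forall_dual_eq fun φ => by
    rw [hF.map_sum_mvfderiv b v φ, hF.dual_componentDeriv]

theorem componentDeriv_add (hF : ComponentwiseSmoothAt I F p) (hG : ComponentwiseSmoothAt I G p)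
    (v : TangentSpace I p) :
    componentDeriv I (fun q => F q + G q) p v = componentDeriv I F p v + componentDeriv I G p v :=
  eq_of_forall_dual_eq fun φ => by
    rw [map_add, (hF.add hG).dual_componentDeriv, hF.dual_componentDeriv, hG.dual_componentDeriv]
    simp only [map_add]
    rw [mvfderiv_fun_add (hF.mdifferentiableAt φ) (hG.mdifferentiableAt φ)]
    rfl

theorem componentDeriv_smul {f : M → ℝ} (hf : ContMDiffAt I 𝓘(ℝ, ℝ) ∞ f p)
    (hF : ComponentwiseSmoothAt I F p) (v : TangentSpace I p) :
    componentDeriv I (fun q => f q • F q) p v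
      = mvfderiv I f p v • F p + f p • componentDeriv I F p v :=
  eq_of_forall_dual_eq fun φ => by
    rw [map_add, map_smul, map_smul, (hF.smul hf).dual_componentDeriv, hF.dual_componentDeriv]
    simp only [map_smul, smul_eq_mul]
    rw [mvfderiv_fun_mul (hf.mdifferentiableAt (by simp)) (hF.mdifferentiableAt φ)]
    simp [mul_comm, add_comm]

theorem componentDeriv_linearMap (L : A →ₗ[ℝ] B) (hF : ComponentwiseSmoothAt I F p)
    (v : TangentSpace I p) :
    componentDeriv I (fun q => L (F q)) p v = L (componentDeriv I F p v) :=
  eq_of_forall_dual_eq fun φ => by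
    rw [(hF.linearMap L).dual_componentDeriv]
    exact (hF.dual_componentDeriv v (φ ∘ₗ L)).symm

end ComponentwiseSmoothAt

theorem componentDeriv_const (a : A) (v : TangentSpace I p) :
    componentDeriv I (fun _ : M => a) p v = 0 :=
  eq_of_forall_dual_eq fun φ => by
    rw [(ComponentwiseSmoothAt.const a).dual_componentDeriv, mvfderiv_const, map_zero]
    rfl

theorem componentDeriv_congr (h : ∀ᶠ q in 𝓝 p, F q = G q) :
    componentDeriv I F p = componentDeriv I G p := by
  unfold componentDeriv
  refine Finset.sum_congr rfl fun s _ => ?_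
  have : (fun q => (Module.finBasis ℝ A).coord s (F q)) =ᶠ[𝓝 p]
      fun q => (Module.finBasis ℝ A).coord s (G q) := h.mono fun q hq => by simp only [hq]
  rw [mvfderiv_congr_of_eventuallyEq this]

theorem componentDeriv_sum {n : Type*} {s : Finset n} {F : n → M → A}
    (hF : ∀ i ∈ s, ComponentwiseSmoothAt I (F i) p) (v : TangentSpace I p) :
    componentDeriv I (fun q => ∑ i ∈ s, F i q) p v = ∑ i ∈ s, componentDeriv I (F i) p v := by
  classical
  induction s using Finset.induction_on with
  | empty => simpa using! componentDeriv_const 0 v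
  | insert i s hi ih =>
    have hs : ∀ j ∈ s, ComponentwiseSmoothAt I (F j) p := fun j hj =>
      hF j (Finset.mem_insert_of_mem hj)
    simp only [Finset.sum_insert hi]
    rw [(hF i (Finset.mem_insert_self i s)).componentDeriv_add (.sum hs), ih hs]

theorem ComponentwiseSmoothAt.componentDeriv_mul {A : Type*} [Ring A] [Algebra ℝ A]
    [FiniteDimensional ℝ A] {F G : M → A} (hF : ComponentwiseSmoothAt I F p)
    (hG : ComponentwiseSmoothAt I G p) (v : TangentSpace I p) :
    componentDeriv I (fun q => F q * G q) p v
      = componentDeriv I F p v * G p + F p * componentDeriv I G p v := by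
  let b := Module.finBasis ℝ A
  have h : (fun q => F q * G q)
      = fun q => ∑ s, b.coord s (F q) • LinearMap.mulLeft ℝ (b s) (G q) := by
    funext q
    conv_lhs => rw [← b.sum_repr (F q), Finset.sum_mul]
    simp
  have hG' : ∀ s, ComponentwiseSmoothAt I (fun q => LinearMap.mulLeft ℝ (b s) (G q)) p :=
    fun s => hG.linearMap _
  rw [h, componentDeriv_sum fun s _ => (hG' s).smul (hF (b.coord s)), ← hF.sum_mvfderiv_eq b v]
  conv_rhs => rw [← b.sum_repr (F p)]
  rw [Finset.sum_mul, Finset.sum_mul, ← Finset.sum_add_distrib]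
  refine Finset.sum_congr rfl fun s _ => ?_
  rw [(hG' s).componentDeriv_smul (hF (b.coord s)), hG.componentDeriv_linearMap]
  simp

theorem componentDeriv_mem (S : Submodule ℝ A) (hF : ComponentwiseSmoothAt I F p)
    (h : ∀ q, F q ∈ S) (v : TangentSpace I p) : componentDeriv I F p v ∈ S := by
  rw [← Submodule.Quotient.mk_eq_zero, ← Submodule.mkQ_apply, ← hF.componentDeriv_linearMap]
  have : (fun q => S.mkQ (F q)) = fun _ => 0 := funext fun q => by
    rw [Submodule.mkQ_apply, (Submodule.Quotient.mk_eq_zero S).2 (h q)]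
  rw [this, componentDeriv_const]

end ComponentDeriv

variable {I} [IsManifold I ∞ M] [FiniteDimensional ℝ E]

/-! ### Values of multivector fields -/

namespace MultivectorField

@[ext]
theorem ext {X Y : MultivectorField I M} (h : ∀ q, X q = Y q) : X = Y := Subtype.ext (funext h)

@[simp] theorem coe_add_apply (X Y : MultivectorField I M) (q : M) : (X + Y) q = X q + Y q := rfl

@[simp] theorem coe_mul_apply (X Y : MultivectorField I M) (q : M) : (X * Y) q = X q * Y q := rfl

@[simp] theorem coe_zero_apply (q : M) : (0 : MultivectorField I M) q = 0 := rfl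

@[simp] theorem coe_one_apply (q : M) : (1 : MultivectorField I M) q = 1 := rfl

@[simp] theorem coe_smul_apply (f : C^∞⟮I, M; ℝ⟯) (X : MultivectorField I M) (q : M) :
    (f • X) q = f q • X q := (Algebra.smul_def (f q) (X q)).symm

@[simp] theorem coe_real_smul_apply (c : ℝ) (X : MultivectorField I M) (q : M) :
    (c • X) q = c • X q := rfl

@[simp] theorem coe_units_smul_apply (c : ℤˣ) (X : MultivectorField I M) (q : M) :
    (c • X) q = c • X q := by
  rcases Int.units_eq_one_or c with rfl | rfl
  · simp only [one_smul]
  · simp only [Units.neg_smul, one_smul]; rfl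

@[simp] theorem coe_sum_apply {n : Type*} (s : Finset n) (X : n → MultivectorField I M) (q : M) :
    (∑ i ∈ s, X i) q = ∑ i ∈ s, X i q := by
  rw [AddSubmonoidClass.coe_finsetSum, Finset.sum_apply]

@[simp] theorem ofFunction_apply (f : C^∞⟮I, M; ℝ⟯) (q : M) :
    ofFunction f q = algebraMap ℝ (ExteriorAlgebra ℝ (TangentSpace I q)) (f q) := rfl

@[simp] theorem ofVectorField_apply (V : SmoothVectorField I M) (q : M) :
    ofVectorField V q = ExteriorAlgebra.ι ℝ (V q) := rfl

theorem ofFunction_mul (f : C^∞⟮I, M; ℝ⟯) (X : MultivectorField I M) :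
    ofFunction f * X = f • X := rfl

theorem ofVectorField_injective :
    Function.Injective (ofVectorField : SmoothVectorField I M → MultivectorField I M) := by
  intro V W h
  ext q
  have : ofVectorField V q = ofVectorField W q := by rw [h]
  exact (ExteriorAlgebra.ι_inj ℝ _ _).1 this

theorem ofVectorField_add (V W : SmoothVectorField I M) :
    ofVectorField (V + W) = ofVectorField V + ofVectorField W := by
  ext q
  exact map_add (ExteriorAlgebra.ι ℝ) (V q) (W q)

theorem ofVectorField_smul (f : C^∞⟮I, M; ℝ⟯) (V : SmoothVectorField I M) :
    ofVectorField (f • V) = f • ofVectorField V := by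
  ext q
  rw [coe_smul_apply]
  exact map_smul (ExteriorAlgebra.ι ℝ) (f q) (V q)

theorem ofFunction_mem (f : C^∞⟮I, M; ℝ⟯) :
    ofFunction f ∈ multivectorFieldsOfDegree I M 0 :=
  fun q => algebraMap_mem_intExteriorPower (f q)

theorem ofVectorField_mem (V : SmoothVectorField I M) :
    ofVectorField V ∈ multivectorFieldsOfDegree I M 1 :=
  fun q => ι_mem_intExteriorPower (V q)

theorem mul_mem_ofDegree {k l : ℤ} {X Y : MultivectorField I M}
    (hX : X ∈ multivectorFieldsOfDegree I M k) (hY : Y ∈ multivectorFieldsOfDegree I M l) :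
    X * Y ∈ multivectorFieldsOfDegree I M (k + l) :=
  fun q => mul_mem_intExteriorPower (hX q) (hY q)

theorem componentwiseSmoothAt_self (X : MultivectorField I M) (p : M) :
    ComponentwiseSmoothAt I (multivectorInChart I p X) p := X.2 p

omit [FiniteDimensional ℝ E] in
theorem multivectorInChart_apply (X : ∀ q : M, ExteriorAlgebra ℝ (TangentSpace I q)) (p q : M) :
    multivectorInChart I p X q = ExteriorAlgebra.map (tangentChart I p q) (X q) := rfl

/-- A multivector field of degree one is a vector field. -/
theorem exists_eq_ofVectorField {X : MultivectorField I M}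
    (hX : X ∈ multivectorFieldsOfDegree I M 1) : ∃ V : SmoothVectorField I M,
      ofVectorField V = X := by
  have h : ∀ q, ExteriorAlgebra.ι ℝ (ExteriorAlgebra.ιInv (X q)) = X q := fun q =>
    ExteriorAlgebra.ι_ιInv_of_mem (hX q)
  refine ⟨⟨fun q => ExteriorAlgebra.ιInv (X q), fun p => ?_⟩, ext h⟩
  refine contMDiffAt_of_componentwiseSmoothAt_tangentChart ?_
  refine ((X.componentwiseSmoothAt_self p).linearMap ExteriorAlgebra.ιInv).congr
    (Eventually.of_forall fun q => ?_)
  rw [multivectorInChart, ← h q, ExteriorAlgebra.map_apply_ι, ExteriorAlgebra.ι_leftInverse,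
    ExteriorAlgebra.ι_leftInverse]

/-! ### The derivative in a chart -/

theorem chartDeriv_eq (X : MultivectorField I M) (p : M) (v : TangentSpace I p) :
    X.chartDeriv p v = ExteriorAlgebra.map (tangentChartSymm I p p)
      (componentDeriv I (multivectorInChart I p X) p v) := by
  rw [← (X.componentwiseSmoothAt_self p).sum_mvfderiv_eq (Module.finBasis ℝ E).ExteriorAlgebra v]
  rfl

theorem chartDeriv_congr {X Y : MultivectorField I M} {p : M} (h : ∀ᶠ q in 𝓝 p, X q = Y q)
    (v : TangentSpace I p) : X.chartDeriv p v = Y.chartDeriv p v := by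
  rw [chartDeriv_eq, chartDeriv_eq, componentDeriv_congr (h.mono fun q hq => ?_)]
  rw [multivectorInChart, multivectorInChart, hq]

theorem chartDeriv_add (X Y : MultivectorField I M) (p : M) (v : TangentSpace I p) :
    (X + Y).chartDeriv p v = X.chartDeriv p v + Y.chartDeriv p v := by
  simp only [chartDeriv_eq]
  rw [← map_add, ← (X.componentwiseSmoothAt_self p).componentDeriv_add
    (Y.componentwiseSmoothAt_self p)]
  congr 2
  congr 1
  funext q
  simp [multivectorInChart_apply]

theorem chartDeriv_mul (X Y : MultivectorField I M) (p : M) (v : TangentSpace I p) :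
    (X * Y).chartDeriv p v = X.chartDeriv p v * Y p + X p * Y.chartDeriv p v := by
  simp only [chartDeriv_eq]
  have h : multivectorInChart I p (X * Y : MultivectorField I M)
      = fun q => multivectorInChart I p X q * multivectorInChart I p Y q := by
    funext q
    simp [multivectorInChart_apply]
  rw [h, (X.componentwiseSmoothAt_self p).componentDeriv_mul (Y.componentwiseSmoothAt_self p),
    map_add, map_mul, map_mul,
    map_tangentChartSymm_multivectorInChart (mem_tangentBase_self p),
    map_tangentChartSymm_multivectorInChart (mem_tangentBase_self p)]

theorem chartDeriv_ofFunction (f : C^∞⟮I, M; ℝ⟯) (p : M) (v : TangentSpace I p) :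
    (ofFunction f).chartDeriv p v = algebraMap ℝ _ (mvfderiv I f p v) := by
  have h : multivectorInChart I p (ofFunction f) = fun q => f q • 1 := by
    funext q
    rw [multivectorInChart_apply, ofFunction_apply, AlgHom.commutes,
      Algebra.algebraMap_eq_smul_one]
  rw [chartDeriv_eq, h, (ComponentwiseSmoothAt.const 1).componentDeriv_smul (f.contMDiff p),
    componentDeriv_const, smul_zero, add_zero, map_smul, map_one, Algebra.algebraMap_eq_smul_one]

theorem chartDeriv_eq_zero_of_constant {X : MultivectorField I M} {p : M}
    {x : ExteriorAlgebra ℝ E} (h : ∀ᶠ q in 𝓝 p, multivectorInChart I p X q = x)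
    (v : TangentSpace I p) : X.chartDeriv p v = 0 := by
  rw [chartDeriv_eq, componentDeriv_congr h, componentDeriv_const, map_zero]

theorem chartDeriv_mem {k : ℤ} {X : MultivectorField I M}
    (hX : X ∈ multivectorFieldsOfDegree I M k) (p : M) (v : TangentSpace I p) :
    X.chartDeriv p v ∈ intExteriorPower (TangentSpace I p) k := by
  rw [chartDeriv_eq]
  exact map_mem_intExteriorPower _ (componentDeriv_mem _ (X.componentwiseSmoothAt_self p)
    (fun q => map_mem_intExteriorPower _ (hX q)) v)

end MultivectorField

/-! ### Decomposable multivector fields -/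

open MultivectorField

theorem wedgeFields_zero (V : Fin 0 → SmoothVectorField I M) : wedgeFields V = 1 := rfl

theorem wedgeFields_succ {k : ℕ} (V : Fin (k + 1) → SmoothVectorField I M) :
    wedgeFields V = ofVectorField (V 0) * wedgeFields (Fin.tail V) := by
  rw [wedgeFields, List.ofFn_succ, List.prod_cons]
  rfl

theorem wedgeFieldsOmit_zero {k : ℕ} (V : Fin (k + 1) → SmoothVectorField I M) :
    wedgeFieldsOmit V 0 = wedgeFields (Fin.tail V) := by
  rw [wedgeFieldsOmit, List.ofFn_succ]
  rfl

theorem wedgeFieldsOmit_succ {k : ℕ} (V : Fin (k + 1) → SmoothVectorField I M) (j : Fin k) :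
    wedgeFieldsOmit V j.succ = ofVectorField (V 0) * wedgeFieldsOmit (Fin.tail V) j := by
  rw [wedgeFieldsOmit, List.ofFn_succ, Fin.val_succ, List.eraseIdx_cons_succ, List.prod_cons]
  rfl

theorem wedgeFields_mem {k : ℕ} (V : Fin k → SmoothVectorField I M) :
    wedgeFields V ∈ multivectorFieldsOfDegree I M k := by
  induction k with
  | zero =>
    rw [wedgeFields_zero, ← map_one ofFunction]
    exact ofFunction_mem 1
  | succ k ih =>
    rw [wedgeFields_succ, Nat.cast_succ, add_comm]
    exact mul_mem_ofDegree (ofVectorField_mem _) (ih _)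

theorem wedgeFields_apply {k : ℕ} (V : Fin k → SmoothVectorField I M) (q : M) :
    wedgeFields V q = ExteriorAlgebra.ιMulti ℝ k fun i => V i q := by
  induction k with
  | zero => rw [wedgeFields_zero, ExteriorAlgebra.ιMulti_zero_apply, coe_one_apply]
  | succ k ih =>
    rw [wedgeFields_succ, coe_mul_apply, ih, ExteriorAlgebra.ιMulti_succ_apply]
    rfl

/-- A property of multivector fields which depends only on the germ at `p` and which is compatible
with sums and with multiplication by functions can be checked on decomposable multivector fields. -/
theorem MultivectorField.local_induction [T2Space M] (p : M) {P : MultivectorField I M → Prop}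
    (congr : ∀ X Y : MultivectorField I M, (∀ᶠ q in 𝓝 p, X q = Y q) → P X → P Y)
    (add : ∀ X Y, P X → P Y → P (X + Y)) (smul : ∀ (f : C^∞⟮I, M; ℝ⟯) X, P X → P (f • X))
    (wedge : ∀ (k : ℕ) (V : Fin k → SmoothVectorField I M), P (wedgeFields V))
    (X : MultivectorField I M) : P X := by
  have hzero : P 0 := by
    have := smul 0 _ (wedge 0 Fin.elim0)
    rwa [zero_smul] at this
  have hp := mem_tangentBase_self (I := I) p
  have hconst : ∀ w : ExteriorAlgebra ℝ E,
      ∃ W : MultivectorField I M, (∀ᶠ q in 𝓝 p, multivectorInChart I p W q = w) ∧ P W := by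
    intro w
    have hw : w ∈ Submodule.span ℝ (Set.range fun x : Σ n, (Fin n → E) =>
        ExteriorAlgebra.ιMulti ℝ x.1 x.2) := by
      rw [ExteriorAlgebra.ιMulti_span]
      exact Submodule.mem_top
    induction hw using Submodule.span_induction with
    | mem w hw =>
      obtain ⟨⟨n, v⟩, rfl⟩ := hw
      choose V hV using fun i =>
        exists_vectorField_constant_in_chart (I := I) p (tangentChartSymm I p p (v i))
      refine ⟨wedgeFields V, ?_, wedge n V⟩
      filter_upwards [eventually_all.2 fun i => (hV i).2] with q hq
      rw [multivectorInChart_apply, wedgeFields_apply, ExteriorAlgebra.map_apply_ιMulti]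
      congr 1
      funext i
      rw [Function.comp_apply, hq i, tangentChart_tangentChartSymm hp]
    | zero => exact ⟨0, Eventually.of_forall fun q => by simp [multivectorInChart_apply], hzero⟩
    | add x y _ _ hx hy =>
      obtain ⟨X, hX, hPX⟩ := hx
      obtain ⟨Y, hY, hPY⟩ := hy
      refine ⟨X + Y, ?_, add X Y hPX hPY⟩
      filter_upwards [hX, hY] with q hXq hYq
      rw [← hXq, ← hYq]
      simp [multivectorInChart_apply]
    | smul c x _ hx =>
      obtain ⟨X, hX, hPX⟩ := hx
      refine ⟨ContMDiffMap.const c • X, ?_, smul _ X hPX⟩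
      filter_upwards [hX] with q hXq
      rw [← hXq, multivectorInChart_apply, coe_smul_apply, map_smul]
      rfl
  let b := (Module.finBasis ℝ E).ExteriorAlgebra
  choose W hW hPW using fun s => hconst (b s)
  choose g hg using fun s => exists_contMDiffMap_eventually_eq (I := I)
    (tangentBase_mem_nhds hp) (f := fun q => b.coord s (multivectorInChart I p X q))
    fun q hq => X.componentwiseSmoothAt hq (b.coord s)
  refine congr (∑ s, g s • W s) X ?_ (Finset.sum_induction _ P add hzero fun s _ =>
    smul _ _ (hPW s))
  filter_upwards [eventually_all.2 hW, eventually_all.2 hg, tangentBase_mem_nhds hp]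
    with q hWq hgq hq
  rw [← map_tangentChartSymm_multivectorInChart hq
      (∑ s, g s • W s : MultivectorField I M).1,
    ← map_tangentChartSymm_multivectorInChart hq X.1]
  congr 1
  conv_rhs => rw [← b.sum_repr (multivectorInChart I p X q)]
  rw [multivectorInChart_apply, coe_sum_apply, map_sum]
  refine Finset.sum_congr rfl fun s _ => ?_
  rw [coe_smul_apply, map_smul, hgq, ← multivectorInChart_apply, hWq, Module.Basis.coord_apply]

end Manifold

section Manifold

variable {E : Type*} [NormedAddCommGroup E] [NormedSpace ℝ E]
  {H : Type*} [TopologicalSpace H] {I : ModelWithCorners ℝ E H}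
  {M : Type*} [TopologicalSpace M] [ChartedSpace H M] [IsManifold I ∞ M] [FiniteDimensional ℝ E]

open Filter Topology MultivectorField

/-! ### The bracket with a function -/

variable (I) in
/-- The basis of the tangent space at `p` which is used in `schoutenBracket`. -/
noncomputable abbrev tangentBasis (p : M) :
    Module.Basis (Fin (Module.finrank ℝ E)) ℝ (TangentSpace I p) :=
  Module.finBasis ℝ E

theorem schoutenBracket_ofFunction (X : MultivectorField I M) (f : C^∞⟮I, M; ℝ⟯) (p : M) :
    schoutenBracket X (ofFunction f) p =
      ∑ i, CliffordAlgebra.contractRight (X p) ((tangentBasis I p).coord i) *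
        (ofFunction f).chartDeriv p (tangentBasis I p i) := by
  refine Finset.sum_congr rfl fun i _ => ?_
  have : CliffordAlgebra.contractLeft ((tangentBasis I p).coord i) (ofFunction f p) = 0 :=
    CliffordAlgebra.contractLeft_algebraMap (Q := (0 : QuadraticForm ℝ (TangentSpace I p))) _ _
  rw [this, mul_zero, sub_zero]

theorem contractRight_ofVectorField (V : SmoothVectorField I M) (p : M)
    (a : Module.Dual ℝ (TangentSpace I p)) :
    CliffordAlgebra.contractRight (ofVectorField V p) a = algebraMap ℝ _ (a (V p)) :=
  CliffordAlgebra.contractRight_ι (Q := (0 : QuadraticForm ℝ (TangentSpace I p))) _ _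

theorem schoutenBracket_ofVectorField_ofFunction (V : SmoothVectorField I M)
    (f : C^∞⟮I, M; ℝ⟯) (p : M) :
    schoutenBracket (ofVectorField V) (ofFunction f) p =
      algebraMap ℝ _ (mvfderiv I f p (V p)) := by
  rw [schoutenBracket_ofFunction]
  conv_rhs => rw [← (tangentBasis I p).sum_repr (V p), map_sum, map_sum]
  refine Finset.sum_congr rfl fun i _ => ?_
  rw [contractRight_ofVectorField, chartDeriv_ofFunction, map_smul, smul_eq_mul, map_mul]
  rfl

/-! ### Locality of higher connections and uniqueness -/

theorem negOnePow_natCast_smul (n : ℕ) (X : MultivectorField I M) :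
    (n : ℤ).negOnePow • X = (-1 : ℝ) ^ n • X := by
  rcases Nat.even_or_odd n with h | h
  · rw [Int.negOnePow_even _ (by exact_mod_cast h), h.neg_one_pow, one_smul, one_smul]
  · rw [Int.negOnePow_odd _ (by exact_mod_cast h), h.neg_one_pow, Units.neg_smul, one_smul,
      neg_smul, one_smul]

namespace HigherConnection

variable (D : HigherConnection I M)

theorem zero_left (Y : MultivectorField I M) : D 0 Y = 0 := by
  simpa using D.function_apply 0 Y

theorem add_left (X X' Y : MultivectorField I M) : D (X + X') Y = D X Y + D X' Y := by
  simpa using D.smul_add_left 1 X X' Y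

theorem smul_left (f : C^∞⟮I, M; ℝ⟯) (X Y : MultivectorField I M) :
    D (f • X) Y = f • D X Y := by
  simpa [D.zero_left] using D.smul_add_left f X 0 Y

section Locality

variable [T2Space M]

theorem congr_left {X X' : MultivectorField I M} {p : M} (h : ∀ᶠ q in 𝓝 p, X q = X' q)
    (Y : MultivectorField I M) : D X Y p = D X' Y p := by
  obtain ⟨g, hg, hg'⟩ := exists_contMDiffMap_eq_zero (I := I) h
  have hX : X = g • (X - X') + X' := by
    ext q
    by_cases hq : X q = X' q
    · simp [hq]
    · simp [hg' q hq]
  conv_lhs => rw [hX]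
  rw [D.smul_add_left, coe_add_apply, coe_smul_apply, hg, zero_smul, zero_add]

theorem congr_right {k : ℤ} {X : MultivectorField I M} (hX : X ∈ multivectorFieldsOfDegree I M k)
    {Y Y' : MultivectorField I M} {p : M} (h : ∀ᶠ q in 𝓝 p, Y q = Y' q) : D X Y p = D X Y' p := by
  obtain ⟨g, hg, hg'⟩ := exists_contMDiffMap_eq_zero (I := I) h
  have hY : Y = g • (Y - Y') + Y' := by
    ext q
    by_cases hq : Y q = Y' q
    · simp [hq]
    · simp [hg' q hq]
  conv_lhs => rw [hY]
  rw [D.add_right, coe_add_apply, D.leibniz k X g _ hX, hg, zero_smul, add_zero]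
  simp [h.self_of_nhds]

end Locality

namespace IsInduced

variable {D} (hD : D.IsInduced)
include hD

theorem apply_wedgeFields_left {k : ℕ} (X : Fin k → SmoothVectorField I M)
    (Y : MultivectorField I M) :
    D (wedgeFields X) Y = ∑ j : Fin k, (-1 : ℝ) ^ (k - (j + 1 : ℕ)) •
      (wedgeFieldsOmit X j * D (ofVectorField (X j)) Y) := by
  induction k with
  | zero =>
    rw [wedgeFields_zero, ← map_one ofFunction, D.function_apply, Finset.univ_eq_empty,
      Finset.sum_empty]
  | succ k ih =>
    rw [wedgeFields_succ, hD.wedge_left 1 k _ _ _ (ofVectorField_mem _) (wedgeFields_mem _), ih,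
      Fin.sum_univ_succ, wedgeFieldsOmit_zero, one_mul, negOnePow_natCast_smul, Finset.mul_sum,
      add_comm]
    congr 1
    refine Finset.sum_congr rfl fun j _ => ?_
    rw [wedgeFieldsOmit_succ, mul_smul_comm, mul_assoc, Fin.val_succ, Nat.add_sub_add_right]
    rfl

theorem apply_wedgeFields_right_of_mem {k : ℤ} {X : MultivectorField I M}
    (hX : X ∈ multivectorFieldsOfDegree I M k) {l : ℕ} (Y : Fin l → SmoothVectorField I M) :
    D X (wedgeFields Y) = ∑ j : Fin l, (-1 : ℝ) ^ (j : ℕ) •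
      (D X (ofVectorField (Y j)) * wedgeFieldsOmit Y j) := by
  induction l with
  | zero =>
    have h1 : (1 : MultivectorField I M) ∈ multivectorFieldsOfDegree I M 0 := by
      rw [← map_one ofFunction]
      exact ofFunction_mem 1
    have h := hD.wedge_right k 0 X 1 1 hX h1
    rw [mul_zero, Int.negOnePow_zero, one_smul, mul_one, mul_one, one_mul,
      left_eq_add] at h
    rw [wedgeFields_zero, h, Finset.univ_eq_empty, Finset.sum_empty]
  | succ l ih =>
    rw [wedgeFields_succ, hD.wedge_right k 1 _ _ _ hX (ofVectorField_mem _), ih,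
      Fin.sum_univ_succ, wedgeFieldsOmit_zero, Finset.mul_sum, Finset.smul_sum]
    congr 1
    · rw [Fin.val_zero, pow_zero, one_smul]
    refine Finset.sum_congr rfl fun j _ => ?_
    have hmem := D.degree k 1 X (ofVectorField (Y j.succ)) hX (ofVectorField_mem _)
    have hcomm : ofVectorField (Y 0) * D X (ofVectorField (Y j.succ))
        = k.negOnePow • (D X (ofVectorField (Y j.succ)) * ofVectorField (Y 0)) := by
      ext q
      have := mul_comm_of_mem_intExteriorPower (ofVectorField_mem (Y 0) q) (hmem q)
      rw [add_sub_cancel_right, one_mul] at this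
      rw [coe_units_smul_apply, coe_mul_apply, this, coe_mul_apply]
    have htail : D X (ofVectorField (Fin.tail Y j)) = D X (ofVectorField (Y j.succ)) := rfl
    rw [wedgeFieldsOmit_succ, mul_smul_comm, ← mul_assoc, htail, hcomm, smul_mul_assoc,
      ← negOnePow_natCast_smul, ← negOnePow_natCast_smul, smul_smul, smul_smul, mul_assoc,
      mul_assoc, ← Int.negOnePow_add, ← Int.negOnePow_add]
    congr 1
    rw [Int.negOnePow_eq_iff, Fin.val_succ]
    refine ⟨k - 1, ?_⟩
    push_cast
    ring

variable [T2Space M]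

theorem apply_wedgeFields_right (X : MultivectorField I M) {l : ℕ}
    (Y : Fin l → SmoothVectorField I M) :
    D X (wedgeFields Y) = ∑ j : Fin l, (-1 : ℝ) ^ (j : ℕ) •
      (D X (ofVectorField (Y j)) * wedgeFieldsOmit Y j) := by
  ext p
  induction X using MultivectorField.local_induction p with
  | congr X X' h hX =>
    rw [← D.congr_left h, hX]
    simp only [coe_sum_apply, coe_real_smul_apply, coe_mul_apply, D.congr_left h]
  | add X X' hX hX' =>
    rw [D.add_left, coe_add_apply, hX, hX', ← coe_add_apply,
      ← Finset.sum_add_distrib]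
    simp only [D.add_left, add_mul, smul_add]
  | smul f X hX =>
    rw [D.smul_left, coe_smul_apply, hX, ← coe_smul_apply, Finset.smul_sum]
    simp only [coe_sum_apply, coe_real_smul_apply, coe_smul_apply, coe_mul_apply, D.smul_left,
      smul_mul_assoc, smul_comm (f p)]
  | wedge k V => rw [hD.apply_wedgeFields_right_of_mem (wedgeFields_mem V)]

/-- A higher connection with the Leibniz rules is determined by its values on vector fields. -/
theorem ext_of_vectorField {D' : HigherConnection I M} (hD' : D'.IsInduced)
    (h : ∀ X Y : SmoothVectorField I M,
      D (ofVectorField X) (ofVectorField Y) = D' (ofVectorField X) (ofVectorField Y)) :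
    D = D' := by
  refine HigherConnection.ext (funext fun X => funext fun Y => MultivectorField.ext fun p => ?_)
  induction X using MultivectorField.local_induction p with
  | congr X X' hX ih => rwa [D.congr_left hX, D'.congr_left hX] at ih
  | add X X' hX hX' =>
    rw [D.add_left, D'.add_left, coe_add_apply, hX, hX', coe_add_apply]
  | smul f X hX => rw [D.smul_left, D'.smul_left, coe_smul_apply, hX, coe_smul_apply]
  | wedge k V =>
    have hV := wedgeFields_mem V
    induction Y using MultivectorField.local_induction p with
    | congr Y Y' hY ih => rwa [D.congr_right hV hY, D'.congr_right hV hY] at ih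
    | add Y Y' hY hY' =>
      rw [D.add_right, D'.add_right, coe_add_apply, hY, hY',
        coe_add_apply]
    | smul f Y hY => rw [D.leibniz k _ _ _ hV, D'.leibniz k _ _ _ hV, hY]
    | wedge l W =>
      simp only [hD.apply_wedgeFields_left, hD'.apply_wedgeFields_left,
        hD.apply_wedgeFields_right, hD'.apply_wedgeFields_right, h]

end IsInduced

/-- The restriction of a higher connection to vector fields. -/
theorem exists_affineConnection (D : HigherConnection I M) :
    ∃ A : AffineConnection I M, ∀ X Y : SmoothVectorField I M,
      ofVectorField (A X Y) = D (ofVectorField X) (ofVectorField Y) := by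
  choose A hA using fun X Y : SmoothVectorField I M => exists_eq_ofVectorField
    (D.degree 1 1 _ _ (ofVectorField_mem X) (ofVectorField_mem Y))
  refine ⟨⟨A, fun f X X' Y => ?_, fun X Y Y' => ?_, fun X f Y p => ?_⟩, hA⟩
  · apply ofVectorField_injective
    rw [hA, ofVectorField_add, ofVectorField_smul, D.smul_add_left, ofVectorField_add,
      ofVectorField_smul, hA, hA]
  · apply ofVectorField_injective
    rw [hA, ofVectorField_add, D.add_right, ofVectorField_add, hA, hA]
  · rw [← ExteriorAlgebra.ι_inj ℝ, map_add, map_smul, map_smul, ← ofVectorField_apply,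
      ← ofVectorField_apply, ← ofVectorField_apply (A X Y), hA, hA, ofVectorField_smul,
      D.leibniz 1 _ _ _ (ofVectorField_mem X), schoutenBracket_ofVectorField_ofFunction,
      ← Algebra.smul_def]

end HigherConnection

end Manifold

section Manifold

variable {E : Type*} [NormedAddCommGroup E] [NormedSpace ℝ E]
  {H : Type*} [TopologicalSpace H] {I : ModelWithCorners ℝ E H}
  {M : Type*} [TopologicalSpace M] [ChartedSpace H M] [IsManifold I ∞ M] [FiniteDimensional ℝ E]

open Filter Topology MultivectorField

/-! ### Locality of affine connections -/

namespace SmoothVectorField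

omit [FiniteDimensional ℝ E] in
theorem coe_smul_apply (f : C^∞⟮I, M; ℝ⟯) (V : SmoothVectorField I M) (q : M) :
    (f • V) q = f q • V q := rfl

omit [FiniteDimensional ℝ E] in
theorem coe_sum_apply {n : Type*} (s : Finset n) (V : n → SmoothVectorField I M) (q : M) :
    (∑ i ∈ s, V i) q = ∑ i ∈ s, V i q := by
  classical
  induction s using Finset.induction_on with
  | empty => rfl
  | insert i s hi ih => rw [Finset.sum_insert hi, Finset.sum_insert hi, ← ih]; rfl

/-- The derivative of a smooth function along a smooth vector field. -/
noncomputable def deriv (V : SmoothVectorField I M) (f : C^∞⟮I, M; ℝ⟯) : C^∞⟮I, M; ℝ⟯ :=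
  ⟨fun q => mvfderiv I f q (V q),
    (contMDiff_snd_tangentBundle_modelSpace ℝ 𝓘(ℝ, ℝ)).comp
      ((f.contMDiff.contMDiff_tangentMap (m := ∞) (by simp)).comp V.contMDiff)⟩

section Frame

variable [T2Space M]

/-- A vector field which extends the `i`-th basis vector at `p` and which is constant in the chart
at `p`, near `p`. -/
noncomputable def frame (p : M) (i : Fin (Module.finrank ℝ E)) : SmoothVectorField I M :=
  (exists_vectorField_constant_in_chart p (tangentBasis I p i)).choose

theorem frame_self (p : M) (i : Fin (Module.finrank ℝ E)) :
    frame (I := I) p i p = tangentBasis I p i :=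
  (exists_vectorField_constant_in_chart p (tangentBasis I p i)).choose_spec.1

theorem eventually_tangentChart_frame (p : M) (i : Fin (Module.finrank ℝ E)) :
    ∀ᶠ q in 𝓝 p, tangentChart I p q (frame p i q) = tangentChart I p p (tangentBasis I p i) :=
  (exists_vectorField_constant_in_chart p (tangentBasis I p i)).choose_spec.2

theorem eventually_eq_sum_frame (V : SmoothVectorField I M) (p : M) :
    ∃ g : Fin (Module.finrank ℝ E) → C^∞⟮I, M; ℝ⟯,
      ∀ᶠ q in 𝓝 p, V q = (∑ i, g i • frame p i : SmoothVectorField I M) q := by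
  have hp := mem_tangentBase_self (I := I) p
  let e : TangentSpace I p ≃ₗ[ℝ] E := LinearEquiv.ofLinearMap (tangentChart I p p)
    (tangentChartSymm I p p) (LinearMap.ext (tangentChart_tangentChartSymm hp))
    (LinearMap.ext (tangentChartSymm_tangentChart hp))
  let b := (tangentBasis I p).map e
  choose g hg using fun i => exists_contMDiffMap_eventually_eq (I := I)
    (tangentBase_mem_nhds hp) (f := fun q => b.coord i (tangentChart I p q (V q)))
    fun q hq => componentwiseSmoothAt_tangentChart hq (V.contMDiff q) (b.coord i)
  refine ⟨g, ?_⟩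
  filter_upwards [eventually_all.2 (eventually_tangentChart_frame (I := I) p),
    eventually_all.2 hg, tangentBase_mem_nhds hp] with q hFq hgq hq
  rw [← tangentChartSymm_tangentChart hq (V q), ← tangentChartSymm_tangentChart hq
    ((∑ i, g i • frame p i : SmoothVectorField I M) q)]
  congr 1
  rw [← b.sum_repr (tangentChart I p q (V q)), coe_sum_apply, map_sum]
  refine Finset.sum_congr rfl fun i _ => ?_
  rw [coe_smul_apply, map_smul, hFq, hgq]
  rfl

end Frame

end SmoothVectorField

open SmoothVectorField (frame frame_self eventually_tangentChart_frame eventually_eq_sum_frame)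

namespace AffineConnection

variable (A : AffineConnection I M)

omit [FiniteDimensional ℝ E] in
theorem one_smul_vectorField (V : SmoothVectorField I M) : (1 : C^∞⟮I, M; ℝ⟯) • V = V := by
  ext q
  exact one_smul ℝ (V q)

omit [FiniteDimensional ℝ E] in
theorem add_left (X X' Y : SmoothVectorField I M) : A (X + X') Y = A X Y + A X' Y := by
  simpa only [one_smul_vectorField] using A.smul_add_left 1 X X' Y

omit [FiniteDimensional ℝ E] in
theorem zero_left (Y : SmoothVectorField I M) : A 0 Y = 0 := by
  simpa using A.add_left 0 0 Y

omit [FiniteDimensional ℝ E] in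
theorem zero_right (X : SmoothVectorField I M) : A X 0 = 0 := by
  simpa using A.add_right X 0 0

omit [FiniteDimensional ℝ E] in
theorem smul_left (f : C^∞⟮I, M; ℝ⟯) (X Y : SmoothVectorField I M) : A (f • X) Y = f • A X Y := by
  simpa only [A.zero_left, add_zero] using A.smul_add_left f X 0 Y

omit [FiniteDimensional ℝ E] in
theorem sum_left {n : Type*} (s : Finset n) (X : n → SmoothVectorField I M)
    (Y : SmoothVectorField I M) : A (∑ i ∈ s, X i) Y = ∑ i ∈ s, A (X i) Y := by
  classical
  induction s using Finset.induction_on with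
  | empty => exact A.zero_left Y
  | insert i s hi ih => rw [Finset.sum_insert hi, Finset.sum_insert hi, A.add_left, ih]

omit [FiniteDimensional ℝ E] in
theorem sum_right {n : Type*} (s : Finset n) (X : SmoothVectorField I M)
    (Y : n → SmoothVectorField I M) : A X (∑ i ∈ s, Y i) = ∑ i ∈ s, A X (Y i) := by
  classical
  induction s using Finset.induction_on with
  | empty => exact A.zero_right X
  | insert i s hi ih => rw [Finset.sum_insert hi, Finset.sum_insert hi, A.add_right, ih]

variable [T2Space M]

theorem congr_left {X X' : SmoothVectorField I M} {p : M} (h : ∀ᶠ q in 𝓝 p, X q = X' q)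
    (Y : SmoothVectorField I M) : A X Y p = A X' Y p := by
  obtain ⟨g, hg, hg'⟩ := exists_contMDiffMap_eq_zero (I := I) h
  have hX : X = g • (X - X') + X' := by
    ext q
    change X q = g q • (X q - X' q) + X' q
    by_cases hq : X q = X' q
    · simp [hq]
    · simp [hg' q hq]
  conv_lhs => rw [hX]
  rw [A.smul_add_left]
  change g p • A (X - X') Y p + A X' Y p = _
  rw [hg, zero_smul, zero_add]

theorem congr_right (X : SmoothVectorField I M) {Y Y' : SmoothVectorField I M} {p : M}
    (h : ∀ᶠ q in 𝓝 p, Y q = Y' q) : A X Y p = A X Y' p := by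
  obtain ⟨g, hg, hg'⟩ := exists_contMDiffMap_eq_zero (I := I) h
  have hY : Y = g • (Y - Y') + Y' := by
    ext q
    change Y q = g q • (Y q - Y' q) + Y' q
    by_cases hq : Y q = Y' q
    · simp [hq]
    · simp [hg' q hq]
  conv_lhs => rw [hY]
  rw [A.add_right]
  change A X (g • (Y - Y')) p + A X Y' p = _
  rw [A.leibniz, hg, zero_smul, add_zero]
  change mvfderiv I g p (X p) • (Y p - Y' p) + A X Y' p = _
  rw [h.self_of_nhds, sub_self, smul_zero, zero_add]

/-- An affine connection is tensorial in its first argument. -/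
theorem eq_sum_frame_left (V W : SmoothVectorField I M) (p : M) :
    A V W p = ∑ i, (tangentBasis I p).coord i (V p) • A (frame p i) W p := by
  obtain ⟨g, hg⟩ := eventually_eq_sum_frame V p
  rw [A.congr_left hg, A.sum_left, SmoothVectorField.coe_sum_apply]
  refine Finset.sum_congr rfl fun i _ => ?_
  rw [A.smul_left, SmoothVectorField.coe_smul_apply, hg.self_of_nhds,
    SmoothVectorField.coe_sum_apply]
  simp only [SmoothVectorField.coe_smul_apply, frame_self]
  rw [Module.Basis.coord_apply, Module.Basis.repr_sum_self]

/-! ### The extension of an affine connection to multivector fields -/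

/-- The covariant derivative at `p` of a multivector field in the direction of the `i`-th basis
vector: the derivation which is determined by the connection. -/
noncomputable def covDerivAt (p : M) (i : Fin (Module.finrank ℝ E)) (Y : MultivectorField I M) :
    ExteriorAlgebra ℝ (TangentSpace I p) :=
  Y.chartDeriv p (tangentBasis I p i) +
    ExteriorAlgebra.sumContract (tangentBasis I p).coord
      (fun j => A (frame p i) (frame p j) p) (Y p)

section covDerivAt

variable (p : M) (i : Fin (Module.finrank ℝ E))

theorem covDerivAt_congr {Y Y' : MultivectorField I M} {p : M} (h : ∀ᶠ q in 𝓝 p, Y q = Y' q) :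
    A.covDerivAt p i Y = A.covDerivAt p i Y' := by
  rw [covDerivAt, covDerivAt, chartDeriv_congr h, h.self_of_nhds]

theorem covDerivAt_add (Y Y' : MultivectorField I M) :
    A.covDerivAt p i (Y + Y') = A.covDerivAt p i Y + A.covDerivAt p i Y' := by
  simp only [covDerivAt, chartDeriv_add, coe_add_apply, map_add]
  abel

theorem covDerivAt_mul (Y Y' : MultivectorField I M) :
    A.covDerivAt p i (Y * Y') = A.covDerivAt p i Y * Y' p + Y p * A.covDerivAt p i Y' := by
  simp only [covDerivAt, chartDeriv_mul, coe_mul_apply, ExteriorAlgebra.sumContract_mul, add_mul,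
    mul_add]
  abel

theorem covDerivAt_ofFunction (f : C^∞⟮I, M; ℝ⟯) :
    A.covDerivAt p i (ofFunction f) = (ofFunction f).chartDeriv p (tangentBasis I p i) := by
  rw [covDerivAt, ofFunction_apply, ExteriorAlgebra.sumContract_algebraMap, add_zero]

theorem covDerivAt_sum {n : Type*} (s : Finset n) (Y : n → MultivectorField I M) :
    A.covDerivAt p i (∑ j ∈ s, Y j) = ∑ j ∈ s, A.covDerivAt p i (Y j) :=
  map_sum (⟨⟨A.covDerivAt p i, by
    rw [← map_zero ofFunction, covDerivAt_ofFunction, chartDeriv_ofFunction]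
    have : mvfderiv I (0 : C^∞⟮I, M; ℝ⟯) p = 0 := mvfderiv_zero
    rw [this]
    exact map_zero _⟩, A.covDerivAt_add p i⟩ :
      MultivectorField I M →+ ExteriorAlgebra ℝ (TangentSpace I p)) Y s

theorem covDerivAt_mem {k : ℤ} {Y : MultivectorField I M}
    (hY : Y ∈ multivectorFieldsOfDegree I M k) :
    A.covDerivAt p i Y ∈ intExteriorPower (TangentSpace I p) k :=
  add_mem (chartDeriv_mem hY p _) (sumContract_mem_intExteriorPower _ _ (hY p))

theorem covDerivAt_frame (j : Fin (Module.finrank ℝ E)) :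
    A.covDerivAt p i (ofVectorField (frame p j))
      = ExteriorAlgebra.ι ℝ (A (frame p i) (frame p j) p) := by
  have h : ∀ᶠ q in 𝓝 p, multivectorInChart I p (ofVectorField (frame p j)) q
      = ExteriorAlgebra.ι ℝ (tangentChart I p p (tangentBasis I p j)) := by
    filter_upwards [eventually_tangentChart_frame (I := I) p j] with q hq
    rw [multivectorInChart_apply, ofVectorField_apply, ExteriorAlgebra.map_apply_ι, hq]
  rw [covDerivAt, chartDeriv_eq_zero_of_constant h, zero_add, ofVectorField_apply,
    ExteriorAlgebra.sumContract_ι, frame_self]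
  congr 1
  simp [Module.Basis.coord_apply, Finsupp.single_apply]

theorem covDerivAt_ofVectorField (W : SmoothVectorField I M) :
    A.covDerivAt p i (ofVectorField W) = ExteriorAlgebra.ι ℝ (A (frame p i) W p) := by
  obtain ⟨g, hg⟩ := eventually_eq_sum_frame W p
  have h : ∀ᶠ q in 𝓝 p, ofVectorField W q
      = (∑ j, ofFunction (g j) * ofVectorField (frame p j) : MultivectorField I M) q := by
    filter_upwards [hg] with q hq
    rw [ofVectorField_apply, hq, SmoothVectorField.coe_sum_apply, map_sum, coe_sum_apply]
    refine Finset.sum_congr rfl fun j _ => ?_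
    rw [ofFunction_mul, MultivectorField.coe_smul_apply, SmoothVectorField.coe_smul_apply,
      map_smul, ofVectorField_apply]
  rw [A.covDerivAt_congr i h, A.congr_right _ hg, covDerivAt_sum, A.sum_right,
    SmoothVectorField.coe_sum_apply, map_sum]
  refine Finset.sum_congr rfl fun j _ => ?_
  rw [covDerivAt_mul, covDerivAt_frame, covDerivAt_ofFunction, chartDeriv_ofFunction, A.leibniz,
    ofFunction_apply, ofVectorField_apply, ← Algebra.smul_def, ← Algebra.smul_def, frame_self p i,
    map_add, map_smul, map_smul]

end covDerivAt

/-- The value at `p` of the induced higher connection. -/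
noncomputable def extendAt (X Y : MultivectorField I M) (p : M) :
    ExteriorAlgebra ℝ (TangentSpace I p) :=
  ∑ i, CliffordAlgebra.contractRight (X p) ((tangentBasis I p).coord i) * A.covDerivAt p i Y

section extendAt

variable (X X' Y Y' Z : MultivectorField I M) (p : M)

theorem extendAt_congr_left {X X' : MultivectorField I M} {p : M} (h : X p = X' p) :
    A.extendAt X Y p = A.extendAt X' Y p := by
  rw [extendAt, extendAt, h]

theorem extendAt_congr_right {Y Y' : MultivectorField I M} {p : M}
    (h : ∀ᶠ q in 𝓝 p, Y q = Y' q) : A.extendAt X Y p = A.extendAt X Y' p := by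
  simp only [extendAt, A.covDerivAt_congr _ h]

theorem extendAt_add_left : A.extendAt (X + X') Y p = A.extendAt X Y p + A.extendAt X' Y p := by
  simp only [extendAt, coe_add_apply, map_add, LinearMap.add_apply, add_mul,
    Finset.sum_add_distrib]

theorem extendAt_smul_left (f : C^∞⟮I, M; ℝ⟯) :
    A.extendAt (f • X) Y p = f p • A.extendAt X Y p := by
  simp only [extendAt, MultivectorField.coe_smul_apply, map_smul, LinearMap.smul_apply,
    smul_mul_assoc, Finset.smul_sum]

theorem extendAt_add_right : A.extendAt X (Y + Y') p = A.extendAt X Y p + A.extendAt X Y' p := by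
  simp only [extendAt, covDerivAt_add, mul_add, Finset.sum_add_distrib]

theorem extendAt_ofFunction_left (f : C^∞⟮I, M; ℝ⟯) : A.extendAt (ofFunction f) Y p = 0 :=
  Finset.sum_eq_zero fun i _ => by
    have : CliffordAlgebra.contractRight (ofFunction f p) ((tangentBasis I p).coord i) = 0 :=
      CliffordAlgebra.contractRight_algebraMap (Q := (0 : QuadraticForm ℝ (TangentSpace I p))) _ _
    rw [this, zero_mul]

theorem extendAt_ofFunction_right (f : C^∞⟮I, M; ℝ⟯) :
    A.extendAt X (ofFunction f) p = schoutenBracket X (ofFunction f) p := by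
  simp only [schoutenBracket_ofFunction, extendAt, covDerivAt_ofFunction]

theorem extendAt_mul_left {k l : ℤ} {X Y : MultivectorField I M}
    (hX : X ∈ multivectorFieldsOfDegree I M k) (hY : Y ∈ multivectorFieldsOfDegree I M l) :
    A.extendAt (X * Y) Z p
      = X p * A.extendAt Y Z p + (k * l).negOnePow • (Y p * A.extendAt X Z p) := by
  simp only [extendAt, Finset.mul_sum, Finset.smul_sum, ← Finset.sum_add_distrib]
  refine Finset.sum_congr rfl fun i _ => ?_
  have h : (k * l).negOnePow = l.negOnePow * ((k - 1) * l).negOnePow := by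
    rw [← Int.negOnePow_add]
    congr 1
    ring
  rw [coe_mul_apply, ExteriorAlgebra.contractRight_mul,
    involute_of_mem_intExteriorPower (hY p), mul_smul_comm,
    mul_comm_of_mem_intExteriorPower (contractRight_mem_intExteriorPower (hX p) _) (hY p),
    smul_smul, ← h, add_mul, smul_mul_assoc, mul_assoc, mul_assoc]

theorem extendAt_mul_right {k l : ℤ} {X Y : MultivectorField I M}
    (hX : X ∈ multivectorFieldsOfDegree I M k) (hY : Y ∈ multivectorFieldsOfDegree I M l) :
    A.extendAt X (Y * Z) p
      = A.extendAt X Y p * Z p + ((k - 1) * l).negOnePow • (Y p * A.extendAt X Z p) := by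
  simp only [extendAt, Finset.mul_sum, Finset.sum_mul, Finset.smul_sum, ← Finset.sum_add_distrib]
  refine Finset.sum_congr rfl fun i _ => ?_
  rw [covDerivAt_mul, mul_add, ← mul_assoc, ← mul_assoc _ (Y p),
    mul_comm_of_mem_intExteriorPower (contractRight_mem_intExteriorPower (hX p) _) (hY p),
    smul_mul_assoc, mul_assoc (Y p)]

theorem extendAt_smul_right {k : ℤ} {X : MultivectorField I M}
    (hX : X ∈ multivectorFieldsOfDegree I M k) (f : C^∞⟮I, M; ℝ⟯) :
    A.extendAt X (f • Y) p
      = schoutenBracket X (ofFunction f) p * Y p + f p • A.extendAt X Y p := by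
  rw [← ofFunction_mul, A.extendAt_mul_right _ _ hX (ofFunction_mem f), mul_zero,
    Int.negOnePow_zero, one_smul, extendAt_ofFunction_right, ofFunction_apply, ← Algebra.smul_def]

theorem extendAt_mem {k l : ℤ} {X Y : MultivectorField I M}
    (hX : X ∈ multivectorFieldsOfDegree I M k) (hY : Y ∈ multivectorFieldsOfDegree I M l) :
    A.extendAt X Y p ∈ intExteriorPower (TangentSpace I p) (k + l - 1) := by
  rw [add_sub_right_comm]
  exact sum_mem fun i _ => mul_mem_intExteriorPower
    (contractRight_mem_intExteriorPower (hX p) _) (A.covDerivAt_mem p i hY)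

theorem extendAt_ofVectorField (V W : SmoothVectorField I M) :
    A.extendAt (ofVectorField V) (ofVectorField W) p = ofVectorField (A V W) p := by
  rw [ofVectorField_apply, eq_sum_frame_left, map_sum]
  refine Finset.sum_congr rfl fun i _ => ?_
  rw [contractRight_ofVectorField, covDerivAt_ofVectorField, ← Algebra.smul_def, map_smul]

end extendAt

/-! ### Smoothness of the extension -/

/-- Smoothness at one point of a section of the exterior bundle. -/
abbrev SmoothMultivectorAt (X : ∀ q : M, ExteriorAlgebra ℝ (TangentSpace I q)) (p : M) : Prop :=
  ComponentwiseSmoothAt I (multivectorInChart I p X) p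

omit [FiniteDimensional ℝ E] [T2Space M] in
theorem SmoothMultivectorAt.congr {X Y : ∀ q : M, ExteriorAlgebra ℝ (TangentSpace I q)} {p : M}
    (hX : SmoothMultivectorAt X p) (h : ∀ᶠ q in 𝓝 p, X q = Y q) : SmoothMultivectorAt Y p :=
  ComponentwiseSmoothAt.congr hX (h.mono fun q hq => by
    rw [multivectorInChart, multivectorInChart, hq])

omit [FiniteDimensional ℝ E] [T2Space M] in
theorem SmoothMultivectorAt.add {X Y : ∀ q : M, ExteriorAlgebra ℝ (TangentSpace I q)} {p : M}
    (hX : SmoothMultivectorAt X p) (hY : SmoothMultivectorAt Y p) :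
    SmoothMultivectorAt (fun q => X q + Y q) p :=
  (ComponentwiseSmoothAt.add hX hY).congr (Eventually.of_forall fun q => by
    simp [multivectorInChart])

omit [FiniteDimensional ℝ E] [T2Space M] in
theorem SmoothMultivectorAt.smul {f : M → ℝ} {X : ∀ q : M, ExteriorAlgebra ℝ (TangentSpace I q)}
    {p : M} (hf : ContMDiffAt I 𝓘(ℝ, ℝ) ∞ f p) (hX : SmoothMultivectorAt X p) :
    SmoothMultivectorAt (fun q => f q • X q) p :=
  (ComponentwiseSmoothAt.smul hf hX).congr (Eventually.of_forall fun q => by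
    simp [multivectorInChart])

omit [T2Space M] in
theorem SmoothMultivectorAt.mul {X Y : ∀ q : M, ExteriorAlgebra ℝ (TangentSpace I q)} {p : M}
    (hX : SmoothMultivectorAt X p) (hY : SmoothMultivectorAt Y p) :
    SmoothMultivectorAt (fun q => X q * Y q) p :=
  (ComponentwiseSmoothAt.mul hX hY).congr (Eventually.of_forall fun q => by
    simp [multivectorInChart])

omit [T2Space M] in
theorem smoothMultivectorAt (X : MultivectorField I M) (p : M) : SmoothMultivectorAt X p := X.2 p

theorem smoothMultivectorAt_extendAt_wedgeFields (p : M) (V : SmoothVectorField I M) {k : ℕ}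
    (W : Fin k → SmoothVectorField I M) :
    SmoothMultivectorAt (A.extendAt (ofVectorField V) (wedgeFields W)) p := by
  induction k with
  | zero =>
    refine (smoothMultivectorAt (ofFunction (V.deriv 1)) p).congr (Eventually.of_forall fun q => ?_)
    rw [wedgeFields_zero, ← map_one ofFunction, extendAt_ofFunction_right,
      schoutenBracket_ofVectorField_ofFunction]
    rfl
  | succ k ih =>
    refine (((smoothMultivectorAt (ofVectorField (A V (W 0))) p).mul
      (smoothMultivectorAt (wedgeFields (Fin.tail W)) p)).add
      ((smoothMultivectorAt (ofVectorField (W 0)) p).mul (ih (Fin.tail W)))).congr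
      (Eventually.of_forall fun q => ?_)
    rw [wedgeFields_succ, A.extendAt_mul_right _ _ (ofVectorField_mem V) (ofVectorField_mem _),
      extendAt_ofVectorField, sub_self, zero_mul, Int.negOnePow_zero, one_smul]

theorem smoothMultivectorAt_extendAt_ofVectorField (p : M) (V : SmoothVectorField I M)
    (Y : MultivectorField I M) : SmoothMultivectorAt (A.extendAt (ofVectorField V) Y) p := by
  induction Y using MultivectorField.local_induction p with
  | congr Y Y' h hY =>
    exact hY.congr (h.eventually_nhds.mono fun q hq => A.extendAt_congr_right _ hq)
  | add Y Y' hY hY' =>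
    exact (hY.add hY').congr (Eventually.of_forall fun q => (A.extendAt_add_right _ _ _ q).symm)
  | smul f Y hY =>
    refine (((smoothMultivectorAt (ofFunction (V.deriv f)) p).mul (smoothMultivectorAt Y p)).add
      (hY.smul (f.contMDiff p))).congr (Eventually.of_forall fun q => ?_)
    rw [A.extendAt_smul_right _ _ (ofVectorField_mem V), schoutenBracket_ofVectorField_ofFunction]
    rfl
  | wedge k W => exact A.smoothMultivectorAt_extendAt_wedgeFields p V W

theorem smoothMultivectorAt_extendAt_wedgeFields_left (p : M) {k : ℕ}
    (V : Fin k → SmoothVectorField I M) (Y : MultivectorField I M) :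
    SmoothMultivectorAt (A.extendAt (wedgeFields V) Y) p := by
  induction k with
  | zero =>
    refine (smoothMultivectorAt 0 p).congr (Eventually.of_forall fun q => ?_)
    rw [wedgeFields_zero, ← map_one ofFunction, extendAt_ofFunction_left]
    rfl
  | succ k ih =>
    refine (((smoothMultivectorAt (ofVectorField (V 0)) p).mul (ih (Fin.tail V))).add
      ((smoothMultivectorAt (((1 * k : ℤ)).negOnePow • wedgeFields (Fin.tail V)) p).mul
      (A.smoothMultivectorAt_extendAt_ofVectorField p (V 0) Y))).congr
      (Eventually.of_forall fun q => ?_)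
    rw [wedgeFields_succ, A.extendAt_mul_left _ _ (ofVectorField_mem _) (wedgeFields_mem _),
      coe_units_smul_apply, smul_mul_assoc]

theorem isSmoothMultivector_extendAt (X Y : MultivectorField I M) :
    IsSmoothMultivector I (A.extendAt X Y) := by
  intro p
  change SmoothMultivectorAt (A.extendAt X Y) p
  induction X using MultivectorField.local_induction p with
  | congr X X' h hX => exact hX.congr (h.mono fun q hq => A.extendAt_congr_left _ hq)
  | add X X' hX hX' =>
    exact (hX.add hX').congr (Eventually.of_forall fun q => (A.extendAt_add_left _ _ _ q).symm)
  | smul f X hX =>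
    exact (hX.smul (f.contMDiff p)).congr
      (Eventually.of_forall fun q => (A.extendAt_smul_left _ _ q f).symm)
  | wedge k V => exact A.smoothMultivectorAt_extendAt_wedgeFields_left p V Y

/-- The higher connection which is induced by an affine connection. -/
noncomputable def toHigherConnection : HigherConnection I M where
  toFun X Y := ⟨A.extendAt X Y, A.isSmoothMultivector_extendAt X Y⟩
  degree _ _ _ _ hX hY p := A.extendAt_mem p hX hY
  smul_add_left f X X' Y := MultivectorField.ext fun p => by
    rw [coe_add_apply, MultivectorField.coe_smul_apply]
    exact (A.extendAt_add_left _ _ _ p).trans (by rw [extendAt_smul_left])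
  add_right X Y Y' := MultivectorField.ext fun p => A.extendAt_add_right X Y Y' p
  apply_function _ X f _ p := A.extendAt_ofFunction_right X p f
  leibniz _ _ f Y hX p := A.extendAt_smul_right Y p hX f
  function_apply f X := MultivectorField.ext fun p => A.extendAt_ofFunction_left X p f

theorem isInduced_toHigherConnection : A.toHigherConnection.IsInduced where
  wedge_left _ _ X Y Z hX hY := MultivectorField.ext fun p => by
    rw [coe_add_apply, coe_units_smul_apply]
    exact A.extendAt_mul_left Z p hX hY
  wedge_right _ _ X Y Z hX hY := MultivectorField.ext fun p => by
    rw [coe_add_apply, coe_units_smul_apply]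
    exact A.extendAt_mul_right Z p hX hY

theorem toHigherConnection_ofVectorField (V W : SmoothVectorField I M) :
    A.toHigherConnection (ofVectorField V) (ofVectorField W) = ofVectorField (A V W) :=
  MultivectorField.ext fun p => A.extendAt_ofVectorField p V W

/-- Affine connections correspond to higher connections with the Leibniz rules. -/
noncomputable def equivHigherConnection :
    AffineConnection I M ≃ {D : HigherConnection I M // D.IsInduced} :=
  Equiv.ofBijective (fun A => ⟨A.toHigherConnection, A.isInduced_toHigherConnection⟩) <| by
    refine ⟨fun A B h => ?_, fun ⟨D, hD⟩ => ?_⟩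
    · refine AffineConnection.ext (funext fun V => funext fun W => ?_)
      apply ofVectorField_injective
      have h' : A.toHigherConnection = B.toHigherConnection := congrArg Subtype.val h
      rw [← toHigherConnection_ofVectorField, h', toHigherConnection_ofVectorField]
    · obtain ⟨A, hA⟩ := D.exists_affineConnection
      refine ⟨A, Subtype.ext (A.isInduced_toHigherConnection.ext_of_vectorField hD fun V W => ?_)⟩
      rw [toHigherConnection_ofVectorField, hA]

end AffineConnection

end Manifold

theorem mainTheorem2 {E : Type*} [NormedAddCommGroup E] [NormedSpace ℝ E] [FiniteDimensional ℝ E]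
    {H : Type*} [TopologicalSpace H] (I : ModelWithCorners ℝ E H)
    (M : Type*) [TopologicalSpace M] [ChartedSpace H M] [IsManifold I ∞ M]
    [BoundarylessManifold I M] [T2Space M] :
    ∃ Φ : AffineConnection I M ≃ {D : HigherConnection I M // D.IsInduced},
      -- `Φ` is inverse to restriction to vector fields
      (∀ (D : AffineConnection I M) (X Y : SmoothVectorField I M),
        (Φ D).1 (.ofVectorField X) (.ofVectorField Y) = .ofVectorField (D X Y)) ∧
      -- the induced connection on decomposable multivector fields
      (∀ (D : AffineConnection I M) (k : ℕ) (X : Fin k → SmoothVectorField I M)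
        (Y : MultivectorField I M),
        (Φ D).1 (wedgeFields X) Y =
          ∑ j : Fin k, (-1 : ℝ) ^ (k - (j + 1 : ℕ)) •
            (wedgeFieldsOmit X j * (Φ D).1 (.ofVectorField (X j)) Y)) ∧
      (∀ (D : AffineConnection I M) (l : ℕ) (X : MultivectorField I M)
        (Y : Fin l → SmoothVectorField I M),
        (Φ D).1 X (wedgeFields Y) =
          ∑ j : Fin l, (-1 : ℝ) ^ (j : ℕ) •
            ((Φ D).1 X (.ofVectorField (Y j)) * wedgeFieldsOmit Y j)) ∧
      (∀ (D : AffineConnection I M) (k l : ℕ) (X : Fin k → SmoothVectorField I M)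
        (Y : Fin l → SmoothVectorField I M),
        (Φ D).1 (wedgeFields X) (wedgeFields Y) =
          ∑ i : Fin k, ∑ j : Fin l, (-1 : ℝ) ^ (k - (i + 1 : ℕ) + (j : ℕ)) •
            (wedgeFieldsOmit X i * .ofVectorField (D (X i) (Y j)) * wedgeFieldsOmit Y j)) := by
  have hind := fun D : AffineConnection I M => D.isInduced_toHigherConnection
  refine ⟨AffineConnection.equivHigherConnection,
    fun D X Y => D.toHigherConnection_ofVectorField X Y,
    fun D k X Y => (hind D).apply_wedgeFields_left X Y,
    fun D l X Y => (hind D).apply_wedgeFields_right X Y, fun D k l X Y => ?_⟩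
  refine ((hind D).apply_wedgeFields_left X _).trans (Finset.sum_congr rfl fun i _ => ?_)
  rw [(hind D).apply_wedgeFields_right, Finset.mul_sum, Finset.smul_sum]
  refine Finset.sum_congr rfl fun j _ => ?_
  rw [D.toHigherConnection_ofVectorField, mul_smul_comm, smul_smul, pow_add, mul_assoc]
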